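/- Let $G_N=N^{-1/2}G$, where $G$ is an $N\times N$ matrix of i.i.d. standard complex normal random variables (real and imaginary parts independent centred Gaussians of variance $1/2$). Let $L>0$ and let $k\ge 0$ be an integer. Then, as $N\to\infty$, uniformly for $z\in\mathbb C$ with $|z|\le 1+L/\sqrt N$, $$\mathbb E\,|\det(G_N-z)|^{2k}=e^{Nk(|z|^2-1)+\frac{k^2}{2}\log N}\,\frac{(2\pi)^{k/2}}{G(1+k)}\,F_k\big(\sqrt N(1-|z|^2)\big)\,(1+o(1)),$$ that is, for every $\varepsilon>0$ there is $N_0=N_0(L,k,\varepsilon)$ such that for all $N\ge N_0$ and all such $z$ the equality holds with a factor $1+\delta$, $|\delta|\le\varepsilon$, in place of $1+o(1)$. Here $G(1+k)$ is the value at $1+k$ of the Barnes $G$-function and $F_k(x)=\mathbb P(\lambda_{\max}<x)$ is the distribution function of the largest eigenvalue $\lambda_{\max}$ of a $k\times k$ GUE matrix, i.e. a random Hermitian matrix $H$ with density proportional to $e^{-\mathrm{Tr}(H^2)/2}$ with respect to the Lebesgue measure on its functionally independent entries (for $k=0$, $F_0\equiv 1$). -/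

import Mathlib

open MeasureTheory ProbabilityTheory Filter

noncomputable section

/-- The law of a standard complex normal random variable `X + iY`, where `X` and `Y` are
independent real centred Gaussian variables of variance `1/2`. -/
def stdComplexNormal : Measure ℂ :=
  ((gaussianReal 0 (1 / 2)).prod (gaussianReal 0 (1 / 2))).map
    (fun p : ℝ × ℝ => (p.1 : ℂ) + (p.2 : ℂ) * Complex.I)

instance instIsProbabilityMeasureStdComplexNormal : IsProbabilityMeasure stdComplexNormal := by
  unfold stdComplexNormal
  exact Measure.isProbabilityMeasure_map (by fun_prop)

/-- The joint law of an `N × N` array of i.i.d. standard complex normal random variables. -/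
def iidComplexNormal (N : ℕ) : Measure (Fin N → Fin N → ℂ) :=
  Measure.pi fun _ => Measure.pi fun _ => stdComplexNormal

instance instIsProbabilityMeasureIidComplexNormal (N : ℕ) :
    IsProbabilityMeasure (iidComplexNormal N) := by
  unfold iidComplexNormal
  infer_instance

/-- The complex Ginibre matrix `G_N = N^{-1/2} G`, as a function of the array `G` of entries. -/
def ginibreMatrix (N : ℕ) (g : Fin N → Fin N → ℂ) : Matrix (Fin N) (Fin N) ℂ :=
  ((Real.sqrt N : ℝ) : ℂ)⁻¹ • Matrix.of g

/-- The moment `𝔼 |det (G_N - z)|^{2k}` of the characteristic polynomial of the complex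
Ginibre matrix. -/
def ginibreMoment (N k : ℕ) (z : ℂ) : ℝ :=
  ∫ g, ‖(ginibreMatrix N g - z • (1 : Matrix (Fin N) (Fin N) ℂ)).det‖ ^ (2 * k)
    ∂(iidComplexNormal N)

/-- The functionally independent entries of a `k × k` Hermitian matrix: the real diagonal entries
and the complex entries strictly above the diagonal. The measure `volume` on this type is the
Lebesgue measure in the real diagonal entries and in the real and imaginary parts of the
others. -/
abbrev HermitianEntries (k : ℕ) : Type :=
  (Fin k → ℝ) × ({p : Fin k × Fin k // p.1 < p.2} → ℂ)

/-- The Hermitian matrix with the given functionally independent entries. -/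
def hermitianOfEntries {k : ℕ} (h : HermitianEntries k) : Matrix (Fin k) (Fin k) ℂ :=
  Matrix.of fun i j =>
    if hij : i < j then h.2 ⟨(i, j), hij⟩
    else if hji : j < i then (starRingEnd ℂ) (h.2 ⟨(j, i), hji⟩)
    else (h.1 i : ℂ)

theorem isHermitian_hermitianOfEntries {k : ℕ} (h : HermitianEntries k) :
    (hermitianOfEntries h).IsHermitian := by
  ext i j
  simp only [hermitianOfEntries, Matrix.conjTranspose_apply, Matrix.of_apply]
  rcases lt_trichotomy i j with hij | rfl | hij
  · simp [hij, hij.not_gt]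
  · simp
  · simp [hij, hij.not_gt]

/-- The unnormalized GUE measure: density `exp (-Tr(H²)/2)` with respect to the Lebesgue measure
on the functionally independent entries of `H`. -/
def gueWeight (k : ℕ) : Measure (HermitianEntries k) :=
  volume.withDensity fun h =>
    ENNReal.ofReal
      (Real.exp (-(Matrix.trace (hermitianOfEntries h * hermitianOfEntries h)).re / 2))

/-- The law of a `k × k` GUE matrix: `gueWeight k` normalized to total mass one. -/
def gueLaw (k : ℕ) : Measure (HermitianEntries k) :=
  (gueWeight k Set.univ)⁻¹ • gueWeight k

/-- The largest eigenvalue of the Hermitian matrix with entries `h`. (Extended-real valued only so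
that the largest eigenvalue of the empty matrix is `-∞`.) -/
def largestEigenvalue {k : ℕ} (h : HermitianEntries k) : EReal :=
  ⨆ i, ((isHermitian_hermitianOfEntries h).eigenvalues i : EReal)

/-- The distribution function `F_k(x) = ℙ(λ_max < x)` of the largest eigenvalue of a `k × k` GUE
matrix. -/
def gueMaxCDF (k : ℕ) (x : ℝ) : ℝ :=
  (gueLaw k).real {h | largestEigenvalue h < (x : EReal)}

/-- The Barnes `G`-function at a real argument `x = 1 + w`, by its Weierstrass product
`G(1+w) = (2π)^{w/2} exp(-(w + (1+γ)w²)/2) ∏_{n ≥ 1} (1 + w/n)^n exp(w²/(2n) - w)`. -/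
def barnesG (x : ℝ) : ℝ :=
  (2 * Real.pi) ^ ((x - 1) / 2) *
    Real.exp (-((x - 1) + (1 + Real.eulerMascheroniConstant) * (x - 1) ^ 2) / 2) *
    ∏' n : ℕ, ((1 + (x - 1) / ((n : ℝ) + 1)) ^ (n + 1) *
      Real.exp ((x - 1) ^ 2 / (2 * ((n : ℝ) + 1)) - (x - 1)))

end

/-! The moment is first computed exactly as an integral over `k × k` Hermitian matrices; the
asymptotics then follow by dominated convergence.

Duality (`integral_norm_det_pow_eq`): `𝔼 |det (G_N - z)|^(2k)` equals `𝔼 det (|z|² + W Wᴴ / N)^N`,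
where `W` is `k × k` with i.i.d. standard complex normal entries. The usual Grassmann argument is
replaced by commutative algebra. For an `n × n` matrix `A`, `n! det A` is a fixed linear functional,
`detFunctional`, of the `n`-th power of the linear form `∑ A x y X (x, y)`. Hence the expected
determinant of a Gaussian affine matrix depends only on its mean and on the quadratic polynomial
recording its covariance (`integral_det_affineMatrix`). The functional kills the ideal `detIdeal`,
which contains all `X (x, y) X (x', y') + X (x, y') X (x', y)`. Modulo this ideal, two Gaussian
matrices of size `2kN` have the same covariance: `k` copies each of `c G - z` and its adjoint, and
`N` copies of the block matrix with rows `(-z, c W)` and `(-c Wᴴ, -conj z)`.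

Change of variables: since `W` is square, `W ↦ W Wᴴ` pushes Lebesgue measure to a constant multiple
of Lebesgue measure on the positive definite cone (`lintegral_mul_conjTranspose`). With `x = √N (1 -
|z|²)` and `W Wᴴ = √N H + √N x`, the matrix `|z|² + W Wᴴ / N` becomes `1 + H / √N`, and positivity
says that all eigenvalues of `H` exceed `-x`. The shift of the trace gives `exp (N k (|z|² - 1))`,
the dilation in real dimension `k²` gives `N^(k²/2)`, and the remaining weight `det (1 + H/√N)^N exp
(-√N Tr H)` tends to `exp (-Tr H² / 2)`. As the GUE is invariant under `H ↦ -H`, the limiting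
integral is a multiple of `F_k(x)`; the constants combine to `(2π)^(k/2) / ∏ j!`, and `∏ j!` over `j
< k` is the Barnes value. So the moment is exactly the main term times a ratio of two integrals over
the same cone (`ginibreMoment_eq_mul`).

Uniformity: the weights are bounded by `exp (k/2 - ‖H‖/2)` for every `N ≥ 1`, so they converge in
`L¹`, which controls the numerator on all cones at once. The denominator is smallest on the smallest
cone, and `|z| ≤ 1 + L/√N` forces `x ≥ -(2L + L²)` (`abs_ratio_sub_one_le`). -/

noncomputable section

open scoped ENNReal ComplexConjugate

/-! ### The Barnes function at positive integers. -/

/-- The factors of the Weierstrass product of the Barnes function at `1 + k`. -/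
def barnesFactor (k : ℝ) (n : ℕ) : ℝ :=
  (1 + k / ((n : ℝ) + 1)) ^ (n + 1) * Real.exp (k ^ 2 / (2 * ((n : ℝ) + 1)) - k)

theorem barnesFactor_pos (k : ℕ) (n : ℕ) : 0 < barnesFactor k n := by
  unfold barnesFactor; positivity

/-- The exponential factor cancels the first two Taylor terms of the logarithm. What is left is `n +
1` times a cubic remainder in `k / (n + 1)`, hence of order `n⁻²`. -/
theorem log_barnesFactor (k n : ℕ) : Real.log (barnesFactor k n) =
    (n + 1) * (Real.log (1 + k / ((n : ℝ) + 1)) - k / ((n : ℝ) + 1)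
      + (k / ((n : ℝ) + 1)) ^ 2 / 2) := by
  have h : (0 : ℝ) < 1 + k / ((n : ℝ) + 1) := by positivity
  rw [barnesFactor, Real.log_mul (by positivity) (by positivity), Real.log_pow, Real.log_exp]
  have : (n : ℝ) + 1 ≠ 0 := by positivity
  push_cast
  field_simp
  ring

/-- The constant `2` bounds `1 / (1 - |x|)` in the Taylor remainder. The estimate serves twice: for
the convergence of the Barnes product and for the Gaussian limit of the determinant weight. -/
theorem abs_log_one_add_sub_le {x : ℝ} (h1 : |x| ≤ 1 / 2) :
    |Real.log (1 + x) - x + x ^ 2 / 2| ≤ 2 * |x| ^ 3 := by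
  have h := Real.abs_log_sub_add_sum_range_le (x := -x) (by rw [abs_neg]; linarith) 2
  rw [abs_neg] at h
  simp only [Finset.sum_range_succ, Finset.sum_range_zero] at h
  norm_num at h
  have e : Real.log (1 + x) - x + x ^ 2 / 2 = -x + x ^ 2 / 2 + Real.log (1 + x) := by ring
  rw [e]
  refine h.trans ?_
  rw [div_le_iff₀ (by linarith)]
  have : 0 ≤ |x| ^ 3 := by positivity
  nlinarith

theorem multipliable_barnesFactor (k : ℕ) : Multipliable (barnesFactor k) := by
  refine Real.multipliable_of_summable_log (barnesFactor_pos k) ?_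
  have hs : Summable (fun n : ℕ => 2 * (k : ℝ) ^ 3 * (1 / ((n : ℝ) + 1) ^ 2)) := by
    refine Summable.mul_left _ ?_
    exact_mod_cast (summable_nat_add_iff 1).2 (Real.summable_one_div_nat_pow.2 one_lt_two)
  refine summable_of_isBigO_nat hs (Asymptotics.IsBigO.of_bound 1 ?_)
  filter_upwards [eventually_ge_atTop (2 * k)] with n hn
  have hn' : (2 * k : ℝ) ≤ n := by exact_mod_cast hn
  have hp : (0 : ℝ) < (n : ℝ) + 1 := by positivity
  have hx := abs_log_one_add_sub_le (x := k / ((n : ℝ) + 1))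
    (by rw [abs_of_nonneg (by positivity), div_le_iff₀ hp]; linarith)
  rw [abs_of_nonneg (a := (k : ℝ) / _) (by positivity)] at hx
  rw [log_barnesFactor, one_mul, Real.norm_eq_abs, Real.norm_eq_abs, abs_mul, abs_of_pos hp,
    abs_of_nonneg (a := _ * (1 / _)) (by positivity)]
  refine (mul_le_mul_of_nonneg_left hx hp.le).trans (le_of_eq ?_)
  field_simp

/-- The ratio of consecutive partial products telescopes. -/
theorem prod_barnesFactor_succ (k M : ℕ) :
    ∏ n ∈ Finset.range M, barnesFactor ((k + 1 : ℕ) : ℝ) n =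
      (∏ n ∈ Finset.range M, barnesFactor k n) *
        ((M + k + 1 : ℝ) ^ M * k.factorial / (M + k).factorial *
          Real.exp ((2 * k + 1) / 2 * (harmonic M : ℝ) - M)) := by
  induction M with
  | zero =>
    have : (k.factorial : ℝ) ≠ 0 := by exact_mod_cast k.factorial_ne_zero
    simp [this]
  | succ M ih =>
    rw [Finset.prod_range_succ, Finset.prod_range_succ, ih, harmonic_succ]
    generalize ∏ n ∈ Finset.range M, barnesFactor (k : ℝ) n = P
    unfold barnesFactor
    have hM : (M : ℝ) + 1 ≠ 0 := by positivity
    have hk : (M : ℝ) + k + 1 ≠ 0 := by positivity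
    have e1 : (1 + ((k + 1 : ℕ) : ℝ) / ((M : ℝ) + 1)) = (M + k + 2) / (M + 1) := by
      push_cast; field_simp; ring
    have e2 : (1 + (k : ℝ) / ((M : ℝ) + 1)) = (M + k + 1) / (M + 1) := by
      field_simp; ring
    have e3 : M + 1 + k = (M + k) + 1 := by ring
    rw [e1, e2, e3, Nat.factorial_succ, div_pow, div_pow]
    have hf : ((M + k).factorial : ℝ) ≠ 0 := by exact_mod_cast (M + k).factorial_ne_zero
    -- Since `(k + 1)² - k² = 2k + 1`, the exponents at `k + 1` and `k` differ by the new harmonic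
    -- term minus one.
    have e4 : Real.exp ((2 * (k : ℝ) + 1) / 2 * ((harmonic M + ((M + 1 : ℕ) : ℚ)⁻¹ : ℚ) : ℝ)
          - ((M + 1 : ℕ) : ℝ)) * Real.exp ((k : ℝ) ^ 2 / (2 * ((M : ℝ) + 1)) - k)
        = Real.exp ((2 * (k : ℝ) + 1) / 2 * (harmonic M : ℝ) - M) *
          Real.exp (((k + 1 : ℕ) : ℝ) ^ 2 / (2 * ((M : ℝ) + 1)) - ((k + 1 : ℕ) : ℝ)) := by
      rw [← Real.exp_add, ← Real.exp_add]
      congr 1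
      push_cast
      field_simp
      ring
    have e5 : ((M + 1 : ℕ) : ℝ) + k + 1 = M + k + 2 := by push_cast; ring
    rw [e5]
    generalize Real.exp ((2 * (k : ℝ) + 1) / 2 * ((harmonic M + ((M + 1 : ℕ) : ℚ)⁻¹ : ℚ) : ℝ)
          - ((M + 1 : ℕ) : ℝ)) = A at e4 ⊢
    generalize Real.exp ((k : ℝ) ^ 2 / (2 * ((M : ℝ) + 1)) - k) = B at e4 ⊢
    generalize Real.exp ((2 * (k : ℝ) + 1) / 2 * (harmonic M : ℝ) - M) = C at e4 ⊢
    generalize Real.exp (((k + 1 : ℕ) : ℝ) ^ 2 / (2 * ((M : ℝ) + 1)) - ((k + 1 : ℕ) : ℝ)) = D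
      at e4 ⊢
    push_cast
    field_simp
    linear_combination (-P * (M + k + 1) ^ M * (M + k + 1)) * e4

theorem tendsto_pow_mul_factorial_div (k : ℕ) :
    Tendsto (fun M : ℕ => (M : ℝ) ^ k * M.factorial / (M + k).factorial) atTop (nhds 1) := by
  induction k with
  | zero =>
    refine tendsto_const_nhds.congr fun M => ?_
    have : (M.factorial : ℝ) ≠ 0 := by exact_mod_cast M.factorial_ne_zero
    simp [this]
  | succ k ih =>
    have h2 : Tendsto (fun M : ℕ => (M : ℝ) / (M + ((k : ℝ) + 1))) atTop (nhds 1) :=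
      tendsto_natCast_div_add_atTop ((k : ℝ) + 1)
    have := ih.mul h2
    rw [one_mul] at this
    refine this.congr fun M => ?_
    rw [← add_assoc M k 1, Nat.factorial_succ]
    have hf : ((M + k).factorial : ℝ) ≠ 0 := by exact_mod_cast (M + k).factorial_ne_zero
    have : (M : ℝ) + k + 1 ≠ 0 := by positivity
    push_cast
    field_simp
    ring

/-- The expression splits into four factors with known limits: `(1 + (k+1)/M)^M`, the quotient `M^k
M! / (M+k)!`, the exponential of `harmonic M - log M` (Euler's constant), and Stirling's sequence
for `M!`. -/
theorem tendsto_barnes_ratio (k : ℕ) :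
    Tendsto (fun M : ℕ => (M + k + 1 : ℝ) ^ M * k.factorial / (M + k).factorial *
          Real.exp ((2 * k + 1) / 2 * (harmonic M : ℝ) - M)) atTop
      (nhds (k.factorial * Real.exp (k + 1) *
        Real.exp ((2 * k + 1) / 2 * Real.eulerMascheroniConstant) *
        (1 / (Real.sqrt 2 * Real.sqrt Real.pi)))) := by
  have ha : Tendsto (fun M : ℕ => (1 + ((k : ℝ) + 1) / M) ^ M) atTop (nhds (Real.exp (k + 1))) :=
    Real.tendsto_one_add_div_pow_exp _
  have hb := tendsto_pow_mul_factorial_div k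
  have hc : Tendsto (fun M : ℕ => Real.exp ((2 * k + 1) / 2 * ((harmonic M : ℝ) - Real.log M)))
      atTop (nhds (Real.exp ((2 * k + 1) / 2 * Real.eulerMascheroniConstant))) :=
    (Real.continuous_exp.tendsto _).comp (Real.tendsto_harmonic_sub_log.const_mul _)
  have hd : Tendsto (fun M : ℕ => 1 / (Real.sqrt 2 * Stirling.stirlingSeq M)) atTop
      (nhds (1 / (Real.sqrt 2 * Real.sqrt Real.pi))) :=
    tendsto_const_nhds.div (Stirling.tendsto_stirlingSeq_sqrt_pi.const_mul _) (by positivity)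
  have := (((ha.const_mul (k.factorial : ℝ)).mul hc).mul hd).mul hb
  rw [mul_one] at this
  refine this.congr' ?_
  filter_upwards [eventually_gt_atTop 0] with M hM
  have hM' : (0 : ℝ) < M := by exact_mod_cast hM
  have e1 : Real.exp ((2 * k + 1) / 2 * ((harmonic M : ℝ) - Real.log M)) =
      Real.exp ((2 * k + 1) / 2 * (harmonic M : ℝ) - M) * Real.exp M
        / ((M : ℝ) ^ k * Real.sqrt M) := by
    have : (M : ℝ) ^ k * Real.sqrt M = Real.exp ((2 * k + 1) / 2 * Real.log M) := by
      rw [Real.sqrt_eq_rpow, ← Real.rpow_natCast, ← Real.rpow_add hM', Real.rpow_def_of_pos hM']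
      congr 1; ring
    rw [this, ← Real.exp_add, ← Real.exp_sub]
    congr 1; ring
  have e2 : (1 + ((k : ℝ) + 1) / M) = (M + k + 1) / M := by field_simp; ring
  rw [e1, e2, Stirling.stirlingSeq, Real.sqrt_mul (by norm_num), div_pow, div_pow, ← Real.exp_nat_mul,
    mul_one]
  have hs2 : Real.sqrt 2 * Real.sqrt 2 = 2 := Real.mul_self_sqrt (by norm_num)
  have hsM : Real.sqrt M * Real.sqrt M = M := Real.mul_self_sqrt hM'.le
  have h1 : Real.sqrt M ≠ 0 := by positivity
  have h3 : (M.factorial : ℝ) ≠ 0 := by exact_mod_cast M.factorial_ne_zero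
  have h4 : ((M + k).factorial : ℝ) ≠ 0 := by exact_mod_cast (M + k).factorial_ne_zero
  have h5 : Real.exp (M : ℝ) ≠ 0 := by positivity
  field_simp

theorem barnesG_eq (k : ℕ) : barnesG (1 + k) = (2 * Real.pi) ^ ((k : ℝ) / 2) *
    Real.exp (-(k + (1 + Real.eulerMascheroniConstant) * k ^ 2) / 2) * ∏' n, barnesFactor k n := by
  simp [barnesG, barnesFactor]

/-- This is `G(z + 1) = Γ(z) G(z)` at integers, from the limit of the ratio of partial products; the
powers of `e` and of `exp γ` cancel against the prefactor. -/
theorem barnesG_one_add_succ (k : ℕ) :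
    barnesG (1 + (k + 1 : ℕ)) = k.factorial * barnesG (1 + k) := by
  have h := (multipliable_barnesFactor k).hasProd.tendsto_prod_nat.mul (tendsto_barnes_ratio k)
  simp only [← prod_barnesFactor_succ] at h
  have := tendsto_nhds_unique (multipliable_barnesFactor (k + 1)).hasProd.tendsto_prod_nat h
  rw [barnesG_eq, barnesG_eq, this]
  have e1 : (2 * Real.pi) ^ (((k + 1 : ℕ) : ℝ) / 2) =
      (2 * Real.pi) ^ ((k : ℝ) / 2) * (Real.sqrt 2 * Real.sqrt Real.pi) := by
    rw [← Real.sqrt_mul (by norm_num), Real.sqrt_eq_rpow, ← Real.rpow_add (by positivity)]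
    congr 1; push_cast; ring
  have e2 : Real.exp (-(((k + 1 : ℕ) : ℝ) + (1 + Real.eulerMascheroniConstant) *
      ((k + 1 : ℕ) : ℝ) ^ 2) / 2) * (Real.exp (k + 1) *
        Real.exp ((2 * k + 1) / 2 * Real.eulerMascheroniConstant)) =
      Real.exp (-(k + (1 + Real.eulerMascheroniConstant) * k ^ 2) / 2) := by
    rw [← Real.exp_add, ← Real.exp_add]
    congr 1; push_cast; ring
  rw [e1, ← e2]
  field_simp

/-- The value of the Barnes function at a positive integer. -/
theorem barnesG_one_add_natCast (k : ℕ) :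
    barnesG (1 + k) = ∏ j ∈ Finset.range k, (j.factorial : ℝ) := by
  induction k with
  | zero => simp [barnesG]
  | succ k ih => rw [barnesG_one_add_succ, ih, Finset.prod_range_succ, mul_comm]

/-! ### Integration over finite powers of a measure space. -/

theorem measurable_fin_cons {X : Type*} [MeasurableSpace X] (n : ℕ) :
    Measurable (fun p : X × (Fin n → X) => (Fin.cons p.1 p.2 : Fin (n + 1) → X)) := by
  rw [measurable_pi_iff]
  intro i
  refine Fin.cases ?_ (fun j => ?_) i
  · simpa using measurable_fst
  · simpa using! (measurable_pi_apply j).comp measurable_snd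

/-- Tonelli's theorem for a finite power, splitting off the first coordinate. -/
theorem lintegral_pi_fin_succ {X : Type*} [MeasurableSpace X] (μ : Measure X) [SigmaFinite μ]
    (n : ℕ) (f : (Fin (n + 1) → X) → ℝ≥0∞) (hf : Measurable f) :
    ∫⁻ x, f x ∂(Measure.pi fun _ : Fin (n + 1) => μ) =
      ∫⁻ a, ∫⁻ b, f (Fin.cons a b) ∂(Measure.pi fun _ : Fin n => μ) ∂μ := by
  have h := (measurePreserving_piFinSuccAbove (fun _ : Fin (n + 1) => μ) 0).symm
  rw [← h.lintegral_comp hf, lintegral_prod]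
  · refine lintegral_congr fun a => lintegral_congr fun b => ?_
    congr 1
    exact Fin.insertNth_zero' a b
  · exact (hf.comp h.measurable).aemeasurable

theorem lintegral_pi_withDensity {X : Type*} [MeasurableSpace X] (μ : Measure X) [SigmaFinite μ]
    (d : X → ℝ≥0∞) (hd : Measurable d) [SigmaFinite (μ.withDensity d)] (n : ℕ)
    (f : (Fin n → X) → ℝ≥0∞) (hf : Measurable f) :
    ∫⁻ x, f x ∂(Measure.pi fun _ : Fin n => μ.withDensity d) =
      ∫⁻ x, (∏ i, d (x i)) * f x ∂(Measure.pi fun _ : Fin n => μ) := by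
  induction n with
  | zero =>
    rw [Measure.pi_of_empty _ Fin.elim0, Measure.pi_of_empty _ Fin.elim0]
    simp
  | succ n ih =>
    have hm := measurable_fin_cons (X := X) n
    have hfc : Measurable fun p : X × (Fin n → X) => f (Fin.cons p.1 p.2) := hf.comp hm
    have hD : Measurable fun x : Fin n → X => ∏ i, d (x i) :=
      Finset.measurable_prod _ fun i _ => hd.comp (measurable_pi_apply i)
    have hD' : Measurable fun x : Fin (n + 1) → X => ∏ i, d (x i) :=
      Finset.measurable_prod _ fun i _ => hd.comp (measurable_pi_apply i)
    rw [lintegral_pi_fin_succ _ _ _ hf, lintegral_pi_fin_succ _ _ (fun x => (∏ i, d (x i)) * f x) (hD'.mul hf)]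
    have h1 : ∀ a, ∫⁻ b, f (Fin.cons a b) ∂(Measure.pi fun _ : Fin n => μ.withDensity d) =
        ∫⁻ b, (∏ i, d (b i)) * f (Fin.cons a b) ∂(Measure.pi fun _ : Fin n => μ) :=
      fun a => ih _ (hfc.comp measurable_prodMk_left)
    simp_rw [h1]
    rw [lintegral_withDensity_eq_lintegral_mul _ hd]
    · refine lintegral_congr fun a => ?_
      rw [Pi.mul_apply, ← lintegral_const_mul]
      · refine lintegral_congr fun b => ?_
        simp [Fin.prod_univ_succ, mul_assoc]
      · exact hD.mul (hfc.comp measurable_prodMk_left)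
    · exact Measurable.lintegral_prod_right' (f := fun p : X × (Fin n → X) =>
        (∏ i, d (p.2 i)) * f (Fin.cons p.1 p.2)) ((hD.comp measurable_snd).mul hfc)

/-! ### Density and mixed moments of the complex normal law. -/

/-- The density of the standard complex normal law. -/
def complexNormalPDF (w : ℂ) : ℝ≥0∞ :=
  ENNReal.ofReal (Real.pi⁻¹ * Real.exp (-‖w‖ ^ 2))

theorem measurable_complexNormalPDF : Measurable complexNormalPDF := by
  unfold complexNormalPDF; fun_prop

theorem stdComplexNormal_eq : stdComplexNormal = volume.withDensity complexNormalPDF := by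
  refine Measure.ext_of_lintegral _ fun f hf => ?_
  have hv : (1 / 2 : NNReal) ≠ 0 := by norm_num
  have hm : Measurable fun p : ℝ × ℝ => (p.1 : ℂ) + (p.2 : ℂ) * Complex.I := by fun_prop
  rw [stdComplexNormal, lintegral_map hf hm, gaussianReal_of_var_ne_zero _ hv,
    prod_withDensity (measurable_gaussianPDF _ _) (measurable_gaussianPDF _ _),
    lintegral_withDensity_eq_lintegral_mul _ (by fun_prop)
      (g := fun p : ℝ × ℝ => f ((p.1 : ℂ) + (p.2 : ℂ) * Complex.I)) (hf.comp hm),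
    lintegral_withDensity_eq_lintegral_mul _ measurable_complexNormalPDF hf,
    ← Complex.volume_preserving_equiv_real_prod.symm.lintegral_comp
      (measurable_complexNormalPDF.mul hf)]
  refine lintegral_congr fun p => ?_
  have e : Complex.measurableEquivRealProd.symm p = (p.1 : ℂ) + (p.2 : ℂ) * Complex.I :=
    Complex.mk_eq_add_mul_I _ _
  rw [Pi.mul_apply, Pi.mul_apply, e]
  congr 1
  rw [complexNormalPDF, gaussianPDF, gaussianPDF, ← ENNReal.ofReal_mul (gaussianPDFReal_nonneg _ _ _)]
  congr 1
  rw [gaussianPDFReal, gaussianPDFReal, Complex.sq_norm, Complex.normSq_add_mul_I]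
  have h2 : 2 * Real.pi * ((1 / 2 : NNReal) : ℝ) = Real.pi := by push_cast; ring
  rw [h2, mul_mul_mul_comm, ← mul_inv, Real.mul_self_sqrt Real.pi_pos.le, ← Real.exp_add]
  congr 2
  push_cast
  ring

theorem integrable_norm_pow_mul_exp (q : ℕ) :
    Integrable fun w : ℂ => ‖w‖ ^ q * Real.exp (-‖w‖ ^ 2) := by
  have h := Complex.integral_rpow_mul_exp_neg_rpow (p := 2) (q := q) (by norm_num)
    (by have : (0 : ℝ) ≤ q := q.cast_nonneg
        linarith)
  simp only [Real.rpow_natCast, Real.rpow_ofNat] at h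
  -- The Bochner integral of a non-integrable function is `0`, whereas the known value is positive.
  refine not_imp_comm.1 integral_undef ?_
  rw [h]
  have := Real.Gamma_pos_of_pos (s := ((q : ℝ) + 2) / 2) (by positivity)
  positivity

theorem integral_norm_pow_mul_exp (p : ℕ) :
    ∫ w : ℂ, ‖w‖ ^ (2 * p) * Real.exp (-‖w‖ ^ 2) = Real.pi * p.factorial := by
  have h := Complex.integral_rpow_mul_exp_neg_rpow (p := 2) (q := (2 * p : ℕ)) (by norm_num)
    (by have : (0 : ℝ) ≤ (2 * p : ℕ) := Nat.cast_nonneg _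
        linarith)
  simp only [Real.rpow_natCast, Real.rpow_ofNat] at h
  rw [h, ← Real.Gamma_nat_eq_factorial]
  push_cast
  congr 2
  · ring
  · ring

theorem integral_pow_mul_conj_pow_mul_exp (p q : ℕ) :
    ∫ w : ℂ, w ^ p * conj w ^ q * (Real.exp (-‖w‖ ^ 2) : ℂ) =
      if p = q then (Real.pi * p.factorial : ℂ) else 0 := by
  split_ifs with h
  · subst h
    have : ∀ w : ℂ, w ^ p * conj w ^ p * (Real.exp (-‖w‖ ^ 2) : ℂ) =
        ((‖w‖ ^ (2 * p) * Real.exp (-‖w‖ ^ 2) : ℝ) : ℂ) := by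
      intro w
      rw [← mul_pow, Complex.mul_conj, Complex.normSq_eq_norm_sq]
      push_cast
      rw [pow_mul]
    simp_rw [this]
    rw [integral_complex_ofReal, integral_norm_pow_mul_exp]
    push_cast; rfl
  -- Rotation by `c` preserves the measure and multiplies the integrand by this constant, so the
  -- integral vanishes. One radian works for all `p ≠ q` at once, because `π` is irrational.
  · obtain ⟨c, hc⟩ : ∃ c : Circle, (c : ℂ) ^ p * conj (c : ℂ) ^ q ≠ 1 := by
      refine ⟨Circle.exp 1, fun hc => ?_⟩
      rw [← Circle.coe_inv_eq_conj, ← Circle.coe_pow, ← Circle.coe_pow, ← Circle.coe_mul,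
        Circle.coe_eq_one, inv_pow, ← Circle.exp_nsmul, ← Circle.exp_nsmul, ← Circle.exp_neg,
        ← Circle.exp_add, Circle.exp_eq_one] at hc
      obtain ⟨m, hm⟩ := hc
      simp only [nsmul_eq_mul, mul_one] at hm
      rcases eq_or_ne m 0 with rfl | hm0
      · apply h
        have : (p : ℝ) = q := by push_cast at hm; linarith
        exact_mod_cast this
      · have hπ : Real.pi = ((p : ℤ) - q : ℤ) / ((2 * m : ℤ) : ℝ) := by
          have : (m : ℝ) ≠ 0 := by exact_mod_cast hm0
          push_cast
          field_simp
          linarith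
        refine irrational_pi ⟨(((p : ℤ) - q : ℤ) : ℚ) / ((2 * m : ℤ) : ℚ), ?_⟩
        rw [hπ]; push_cast; rfl
    have hmp := (rotation c).measurePreserving
    have key := hmp.integral_comp' (f := (rotation c).toHomeomorph.toMeasurableEquiv)
      (g := fun w : ℂ => w ^ p * conj w ^ q * (Real.exp (-‖w‖ ^ 2) : ℂ))
    have e : ∀ w : ℂ, ((rotation c).toHomeomorph.toMeasurableEquiv w) ^ p *
        conj ((rotation c).toHomeomorph.toMeasurableEquiv w) ^ q *
        (Real.exp (-‖(rotation c).toHomeomorph.toMeasurableEquiv w‖ ^ 2) : ℂ) =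
        ((c : ℂ) ^ p * conj (c : ℂ) ^ q) * (w ^ p * conj w ^ q * (Real.exp (-‖w‖ ^ 2) : ℂ)) := by
      intro w
      have : (rotation c).toHomeomorph.toMeasurableEquiv w = c * w := rfl
      rw [this, norm_mul, Circle.norm_coe, one_mul, map_mul, mul_pow, mul_pow]
      ring
    simp_rw [e] at key
    rw [integral_const_mul] at key
    by_contra h0
    exact hc (mul_right_cancel₀ h0 (by rw [key, one_mul]))

theorem complexNormalPDF_toReal_smul (w : ℂ) (a : ℂ) :
    (complexNormalPDF w).toReal • a = (Real.pi : ℂ)⁻¹ * (a * (Real.exp (-‖w‖ ^ 2) : ℂ)) := by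
  rw [complexNormalPDF, ENNReal.toReal_ofReal (by positivity), Complex.real_smul]
  push_cast
  ring

theorem integrable_pow_mul_conj_pow_stdComplexNormal (p q : ℕ) :
    Integrable (fun w : ℂ => w ^ p * conj w ^ q) stdComplexNormal := by
  rw [stdComplexNormal_eq, integrable_withDensity_iff_integrable_smul'
    measurable_complexNormalPDF (by simp [complexNormalPDF])]
  simp_rw [complexNormalPDF_toReal_smul]
  refine Integrable.const_mul ?_ _
  refine (integrable_norm_pow_mul_exp (p + q)).mono' (by fun_prop) (ae_of_all _ fun w => ?_)
  rw [norm_mul, norm_mul, norm_pow, norm_pow, RCLike.norm_conj, ← pow_add, Complex.norm_real,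
    Real.norm_of_nonneg (by positivity)]

/-- The mixed moments of the standard complex normal law. -/
theorem integral_pow_mul_conj_pow_stdComplexNormal (p q : ℕ) :
    ∫ w : ℂ, w ^ p * conj w ^ q ∂stdComplexNormal = if p = q then (p.factorial : ℂ) else 0 := by
  rw [stdComplexNormal_eq, integral_withDensity_eq_integral_toReal_smul
    measurable_complexNormalPDF (by simp [complexNormalPDF])]
  simp_rw [complexNormalPDF_toReal_smul]
  rw [integral_const_mul, integral_pow_mul_conj_pow_mul_exp]
  split_ifs
  · rw [inv_mul_cancel_left₀ (by exact_mod_cast Real.pi_ne_zero)]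
  · simp

/-! ### The determinant as a functional on commutative polynomials. -/

section DetFunctional

variable {n : Type*} [Fintype n] [DecidableEq n]

/-- The exponent of the monomial `∏ x, X (x, π x)`. -/
def permExponent (π : Equiv.Perm n) : n × n →₀ ℕ :=
  Finsupp.equivFunOnFinite.symm fun p => if π p.1 = p.2 then 1 else 0

theorem permExponent_apply (π : Equiv.Perm n) (p : n × n) :
    permExponent π p = if π p.1 = p.2 then 1 else 0 := rfl

theorem permExponent_row_sum (π : Equiv.Perm n) (x : n) : ∑ y, permExponent π (x, y) = 1 := by
  simp [permExponent_apply]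

/-- The linear functional on polynomials in the entries of a matrix which reads off the signed sum
of the coefficients of the monomials occurring in the determinant. -/
def detFunctional (n : Type*) [Fintype n] [DecidableEq n] : MvPolynomial (n × n) ℂ →ₗ[ℂ] ℂ :=
  ∑ π : Equiv.Perm n, ((Equiv.Perm.sign π : ℤ) : ℂ) • MvPolynomial.lcoeff ℂ (permExponent π)

theorem detFunctional_apply (s : MvPolynomial (n × n) ℂ) : detFunctional n s =
    ∑ π : Equiv.Perm n, ((Equiv.Perm.sign π : ℤ) : ℂ) * MvPolynomial.coeff (permExponent π) s := by
  simp [detFunctional]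

/-- The linear form attached to a matrix. -/
def linearFormOfMatrix (A : Matrix n n ℂ) : MvPolynomial (n × n) ℂ :=
  ∑ p : n × n, MvPolynomial.C (A p.1 p.2) * MvPolynomial.X p

/-- In the multinomial theorem, exponents at most `1` make every factorial in the denominator
trivial, so the multinomial coefficient is `m!`. -/
theorem coeff_linearForm_pow {σ : Type*} [Fintype σ] [DecidableEq σ] (a : σ → ℂ) (m : ℕ)
    (e : σ →₀ ℕ) (he : ∀ i, e i ≤ 1) (hm : ∑ i, e i = m) :
    MvPolynomial.coeff e ((∑ i, MvPolynomial.C (a i) * MvPolynomial.X i) ^ m) =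
      m.factorial * ∏ i, a i ^ e i := by
  rw [Finset.sum_pow_eq_sum_piAntidiag, MvPolynomial.coeff_sum]
  have hterm : ∀ k : σ → ℕ, (Nat.multinomial Finset.univ k : MvPolynomial σ ℂ) *
      ∏ i, (MvPolynomial.C (a i) * MvPolynomial.X i) ^ k i =
      MvPolynomial.monomial (Finsupp.equivFunOnFinite.symm k)
        (Nat.multinomial Finset.univ k * ∏ i, a i ^ k i) := by
    intro k
    simp_rw [mul_pow, Finset.prod_mul_distrib]
    rw [MvPolynomial.monomial_eq, Finsupp.prod_fintype _ _ (by simp)]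
    simp [mul_assoc]
  simp_rw [hterm, MvPolynomial.coeff_monomial]
  rw [Finset.sum_eq_single (e : σ → ℕ)]
  · rw [if_pos (by ext; simp)]
    congr 2
    rw [Nat.multinomial, hm, Finset.prod_eq_one, Nat.div_one]
    intro i _
    have := he i
    interval_cases e i <;> rfl
  · intro k _ hk
    rw [if_neg]
    intro h
    apply hk
    ext i
    rw [← h]; simp
  · intro h
    exact absurd (by simpa [Finset.mem_piAntidiag] using hm) h

/-- This turns the determinant of a random matrix into a power of a scalar Gaussian form, whose
expectation obeys a two-term recursion. -/
theorem detFunctional_linearForm_pow (A : Matrix n n ℂ) :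
    detFunctional n (linearFormOfMatrix A ^ Fintype.card n) =
      (Fintype.card n).factorial * A.det := by
  rw [detFunctional_apply, ← Matrix.det_transpose, Matrix.det_apply', Finset.mul_sum]
  refine Finset.sum_congr rfl fun π _ => ?_
  rw [linearFormOfMatrix, coeff_linearForm_pow (fun p : n × n => A p.1 p.2)]
  · rw [Fintype.prod_prod_type]
    simp [permExponent_apply, pow_ite, Matrix.transpose_apply]
    ring
  · intro p
    rw [permExponent_apply]; split_ifs <;> simp
  · rw [Fintype.sum_prod_type]
    simp [permExponent_row_sum]

/-- Both sides are padded by the variables being exchanged, so that no truncated subtraction of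
exponents occurs. -/
theorem permExponent_mul_swap (π : Equiv.Perm n) {x x' : n} (hx : x ≠ x') :
    permExponent (π * Equiv.swap x x') + Finsupp.single (x, π x) 1 + Finsupp.single (x', π x') 1 =
      permExponent π + Finsupp.single (x, π x') 1 + Finsupp.single (x', π x) 1 := by
  ext ⟨a, b⟩
  simp only [Finsupp.add_apply, permExponent_apply, Finsupp.single_apply, Equiv.Perm.mul_apply,
    Prod.mk.injEq]
  rcases eq_or_ne a x with rfl | h1
  · simp [hx.symm]
    ring
  · rcases eq_or_ne a x' with rfl | h2
    · simp [hx]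
      ring
    · simp [Equiv.swap_apply_of_ne_of_ne h1 h2, h1.symm, h2.symm]

/-- The two displayed variables must occur in the monomial of `π`, which forces `π x = y` and `π x'
= y'`; composing with the transposition then exchanges the two columns. -/
theorem permExponent_eq_swap {π : Equiv.Perm n} {x x' y y' : n} (hx : x ≠ x') {β : n × n →₀ ℕ}
    (h : Finsupp.single (x, y) 1 + Finsupp.single (x', y') 1 + β = permExponent π) :
    Finsupp.single (x, y') 1 + Finsupp.single (x', y) 1 + β =
      permExponent (π * Equiv.swap x x') := by
  have h1 : π x = y := by
    by_contra hn
    have := DFunLike.congr_fun h (x, y)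
    simp [permExponent_apply, hn] at this
  have h2 : π x' = y' := by
    by_contra hn
    have := DFunLike.congr_fun h (x', y')
    simp [permExponent_apply, hn] at this
  have key := permExponent_mul_swap π hx
  rw [h1, h2, ← h] at key
  refine add_right_cancel (b := Finsupp.single (x, y) 1 + Finsupp.single (x', y') 1) ?_
  rw [← add_assoc (permExponent _), key]
  abel

/-- The functional annihilates the ideal of antisymmetry relations. -/
theorem detFunctional_relation (x x' y y' : n) (t : MvPolynomial (n × n) ℂ) :
    detFunctional n ((MvPolynomial.X (x, y) * MvPolynomial.X (x', y') +
      MvPolynomial.X (x, y') * MvPolynomial.X (x', y)) * t) = 0 := by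
  induction t using MvPolynomial.induction_on' with
  | add p q hp hq => rw [mul_add, map_add, hp, hq, add_zero]
  | monomial β b =>
    have hm : ∀ y y' : n, (MvPolynomial.X (x, y) * MvPolynomial.X (x', y') *
        MvPolynomial.monomial β b : MvPolynomial (n × n) ℂ) =
        MvPolynomial.monomial (Finsupp.single (x, y) 1 + Finsupp.single (x', y') 1 + β) b := by
      intro y y'
      rw [MvPolynomial.X, MvPolynomial.X, MvPolynomial.monomial_mul, MvPolynomial.monomial_mul]
      simp
    rw [add_mul, map_add, hm, hm, detFunctional_apply, detFunctional_apply]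
    simp_rw [MvPolynomial.coeff_monomial]
    rcases eq_or_ne x x' with rfl | hx
    · have h0 : ∀ (y y' : n) (π : Equiv.Perm n),
          Finsupp.single (x, y) 1 + Finsupp.single (x, y') 1 + β ≠ permExponent π := by
        intro y y' π h
        have h1 := permExponent_row_sum π x
        rw [← h] at h1
        simp [Finset.sum_add_distrib, Finsupp.single_apply] at h1
        omega
      simp [h0]
    -- Pairing `π` with `π * swap x x'` matches the two monomials with opposite signs.
    · rw [← Equiv.sum_comp (Equiv.mulRight (Equiv.swap x x')), ← Finset.sum_add_distrib]
      refine Finset.sum_eq_zero fun π _ => ?_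
      have hiff : Finsupp.single (x, y) 1 + Finsupp.single (x', y') 1 + β =
            permExponent (π * Equiv.swap x x') ↔
          Finsupp.single (x, y') 1 + Finsupp.single (x', y) 1 + β = permExponent π := by
        refine ⟨fun h => ?_, fun h => permExponent_eq_swap hx h⟩
        have := permExponent_eq_swap hx h
        rwa [mul_assoc, Equiv.swap_mul_self, mul_one] at this
      rw [Equiv.coe_mulRight, Equiv.Perm.sign_mul, Equiv.Perm.sign_swap hx]
      simp only [hiff]
      split_ifs <;> simp

/-- The largest ideal contained in the kernel of the functional. -/
def detIdeal (n : Type*) [Fintype n] [DecidableEq n] : Ideal (MvPolynomial (n × n) ℂ) where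
  carrier := {s | ∀ t, detFunctional n (s * t) = 0}
  add_mem' := fun {a b} ha hb t => by rw [add_mul, map_add, ha t, hb t, add_zero]
  zero_mem' := fun t => by simp
  smul_mem' := fun c s hs t => by
    rw [smul_eq_mul, mul_comm c s, mul_assoc]; exact hs _

theorem detFunctional_eq_of_sub_mem {s t : MvPolynomial (n × n) ℂ} (h : s - t ∈ detIdeal n) :
    detFunctional n s = detFunctional n t := by
  have := h 1
  rwa [mul_one, map_sub, sub_eq_zero] at this

/-- Modulo this ideal, `X (x, y)` behaves like a product `ψ̄ x * ψ y` of anticommuting variables: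
exchanging two column indices costs a sign. -/
theorem relation_mem_detIdeal (x x' y y' : n) :
    (MvPolynomial.X (x, y) * MvPolynomial.X (x', y') +
      MvPolynomial.X (x, y') * MvPolynomial.X (x', y) : MvPolynomial (n × n) ℂ) ∈ detIdeal n :=
  fun t => detFunctional_relation x x' y y' t

end DetFunctional

/-! ### Algebraic Gaussian expectation and Wick's recursion. -/

section GaussFunctional

variable {ι : Type*} [Fintype ι] {B : Type*} [CommRing B]

/-- The moments of a family of independent standard complex normal variables. -/
def gaussMoment (α : ι ⊕ ι →₀ ℕ) : ℕ :=
  ∏ i, if α (Sum.inl i) = α (Sum.inr i) then (α (Sum.inl i)).factorial else 0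

/-- The algebraic Gaussian expectation of a polynomial in the variables `X (inl i)` and their
conjugates `X (inr i)`. -/
def gaussFunctional (ι : Type*) [Fintype ι] (B : Type*) [CommRing B] :
    MvPolynomial (ι ⊕ ι) B →ₗ[B] B :=
  (MvPolynomial.basisMonomials (ι ⊕ ι) B).constr B fun α => (gaussMoment α : B)

theorem gaussFunctional_monomial (α : ι ⊕ ι →₀ ℕ) (b : B) :
    gaussFunctional ι B (MvPolynomial.monomial α b) = b * gaussMoment α := by
  have h : MvPolynomial.monomial α b = b • MvPolynomial.basisMonomials (ι ⊕ ι) B α := by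
    rw [MvPolynomial.coe_basisMonomials, MvPolynomial.smul_monomial, smul_eq_mul, mul_one]
  rw [h, map_smul, gaussFunctional, Module.Basis.constr_basis, smul_eq_mul]

/-- Only the `i`-th factor changes, through `(m + 1)! = (m + 1) m!`. If the exponent on the right is
`0`, its truncated predecessor is harmless because the coefficient vanishes. -/
theorem gaussMoment_add_inl [DecidableEq ι] (α : ι ⊕ ι →₀ ℕ) (i : ι) :
    gaussMoment (Finsupp.single (Sum.inl i) 1 + α) =
      α (Sum.inr i) * gaussMoment (α - Finsupp.single (Sum.inr i) 1) := by
  unfold gaussMoment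
  rw [← Finset.mul_prod_erase _ _ (Finset.mem_univ i),
    ← Finset.mul_prod_erase (Finset.univ : Finset ι) _ (Finset.mem_univ i), ← mul_assoc]
  congr 1
  · simp only [Finsupp.add_apply, Finsupp.single_eq_same, Finsupp.tsub_apply]
    rw [Finsupp.single_eq_of_ne (by simp), Finsupp.single_eq_of_ne (by simp)]
    rcases h : α (Sum.inr i) with _ | m
    · simp
    · simp only [zero_add, tsub_zero, Nat.add_sub_cancel]
      rw [add_comm 1]
      by_cases h' : α (Sum.inl i) = m
      · simp [h', Nat.factorial_succ]
      · simp [h']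
  · refine Finset.prod_congr rfl fun j hj => ?_
    have hne : i ≠ j := (Finset.ne_of_mem_erase hj).symm
    simp [hne]

theorem gaussMoment_add_inr [DecidableEq ι] (α : ι ⊕ ι →₀ ℕ) (i : ι) :
    gaussMoment (Finsupp.single (Sum.inr i) 1 + α) =
      α (Sum.inl i) * gaussMoment (α - Finsupp.single (Sum.inl i) 1) := by
  unfold gaussMoment
  rw [← Finset.mul_prod_erase _ _ (Finset.mem_univ i),
    ← Finset.mul_prod_erase (Finset.univ : Finset ι) _ (Finset.mem_univ i), ← mul_assoc]
  congr 1
  · simp only [Finsupp.add_apply, Finsupp.single_eq_same, Finsupp.tsub_apply]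
    rw [Finsupp.single_eq_of_ne (by simp), Finsupp.single_eq_of_ne (by simp)]
    rcases h : α (Sum.inl i) with _ | m
    · simp; omega
    · simp only [zero_add, tsub_zero, Nat.add_sub_cancel]
      rw [add_comm 1]
      by_cases h' : m = α (Sum.inr i)
      · simp [← h', Nat.factorial_succ]
      · simp [h']
  · refine Finset.prod_congr rfl fun j hj => ?_
    have hne : i ≠ j := (Finset.ne_of_mem_erase hj).symm
    simp [hne]

/-- Gaussian integration by parts. -/
theorem gaussFunctional_X_inl_mul [DecidableEq ι] (i : ι) (Y : MvPolynomial (ι ⊕ ι) B) :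
    gaussFunctional ι B (MvPolynomial.X (Sum.inl i) * Y) =
      gaussFunctional ι B (MvPolynomial.pderiv (Sum.inr i) Y) := by
  induction Y using MvPolynomial.induction_on' with
  | add p q hp hq => rw [mul_add, map_add, map_add, map_add, hp, hq]
  | monomial α b =>
    rw [MvPolynomial.X, MvPolynomial.monomial_mul, one_mul, MvPolynomial.pderiv_monomial,
      gaussFunctional_monomial, gaussFunctional_monomial, gaussMoment_add_inl]
    push_cast
    ring

theorem gaussFunctional_X_inr_mul [DecidableEq ι] (i : ι) (Y : MvPolynomial (ι ⊕ ι) B) :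
    gaussFunctional ι B (MvPolynomial.X (Sum.inr i) * Y) =
      gaussFunctional ι B (MvPolynomial.pderiv (Sum.inl i) Y) := by
  induction Y using MvPolynomial.induction_on' with
  | add p q hp hq => rw [mul_add, map_add, map_add, map_add, hp, hq]
  | monomial α b =>
    rw [MvPolynomial.X, MvPolynomial.monomial_mul, one_mul, MvPolynomial.pderiv_monomial,
      gaussFunctional_monomial, gaussFunctional_monomial, gaussMoment_add_inr]
    push_cast
    ring

theorem gaussFunctional_C_mul (b : B) (Y : MvPolynomial (ι ⊕ ι) B) :
    gaussFunctional ι B (MvPolynomial.C b * Y) = b * gaussFunctional ι B Y := by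
  rw [← MvPolynomial.smul_eq_C_mul, map_smul, smul_eq_mul]

/-- Wick polynomials: the moments of a Gaussian variable of mean `m` and variance `2 Q`. -/
def wickPoly (m Q : B) : ℕ → B
  | 0 => 1
  | 1 => m
  | (r + 2) => m * wickPoly m Q (r + 1) + 2 * (r + 1 : ℕ) * Q * wickPoly m Q r

/-- A general affine form in complex Gaussian variables. -/
def gaussForm (m : B) (u v : ι → B) : MvPolynomial (ι ⊕ ι) B :=
  MvPolynomial.C m + ∑ i, (MvPolynomial.C (u i) * MvPolynomial.X (Sum.inl i) +
    MvPolynomial.C (v i) * MvPolynomial.X (Sum.inr i))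

theorem pderiv_inl_gaussForm [DecidableEq ι] (m : B) (u v : ι → B) (i : ι) :
    MvPolynomial.pderiv (Sum.inl i) (gaussForm m u v) = MvPolynomial.C (u i) := by
  simp [gaussForm, MvPolynomial.pderiv_X, Pi.single_apply]

theorem pderiv_inr_gaussForm [DecidableEq ι] (m : B) (u v : ι → B) (i : ι) :
    MvPolynomial.pderiv (Sum.inr i) (gaussForm m u v) = MvPolynomial.C (v i) := by
  simp [gaussForm, MvPolynomial.pderiv_X, Pi.single_apply]

/-- One factor is expanded and each variable is integrated by parts. The `2` arises because `u i * v
i` appears once from the variable and once from its conjugate; at `r = 0` the truncated power has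
coefficient zero. -/
theorem gaussFunctional_gaussForm_pow_succ [DecidableEq ι] (m : B) (u v : ι → B) (r : ℕ) :
    gaussFunctional ι B (gaussForm m u v ^ (r + 1)) =
      m * gaussFunctional ι B (gaussForm m u v ^ r) +
        2 * r * (∑ i, u i * v i) * gaussFunctional ι B (gaussForm m u v ^ (r - 1)) := by
  have hexp : gaussForm m u v ^ (r + 1) = MvPolynomial.C m * gaussForm m u v ^ r +
      ∑ i, (MvPolynomial.C (u i) * (MvPolynomial.X (Sum.inl i) * gaussForm m u v ^ r) +
        MvPolynomial.C (v i) * (MvPolynomial.X (Sum.inr i) * gaussForm m u v ^ r)) := by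
    rw [pow_succ']
    nth_rewrite 1 [gaussForm]
    rw [add_mul, Finset.sum_mul]
    congr 1
    exact Finset.sum_congr rfl fun i _ => by ring
  rw [hexp, map_add, map_sum, gaussFunctional_C_mul]
  congr 1
  rw [Finset.mul_sum, Finset.sum_mul]
  refine Finset.sum_congr rfl fun i _ => ?_
  rw [map_add, gaussFunctional_C_mul, gaussFunctional_C_mul, gaussFunctional_X_inl_mul,
    gaussFunctional_X_inr_mul, MvPolynomial.pderiv_pow, MvPolynomial.pderiv_pow,
    pderiv_inl_gaussForm, pderiv_inr_gaussForm]
  have hc : ∀ b : B, ((r : MvPolynomial (ι ⊕ ι) B) * gaussForm m u v ^ (r - 1) *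
      MvPolynomial.C b) = MvPolynomial.C (r * b) * gaussForm m u v ^ (r - 1) := by
    intro b
    rw [map_mul, map_natCast]; ring
  rw [hc, hc, gaussFunctional_C_mul, gaussFunctional_C_mul]
  ring

theorem gaussFunctional_gaussForm_pow [DecidableEq ι] (m : B) (u v : ι → B) (r : ℕ) :
    gaussFunctional ι B (gaussForm m u v ^ r) = wickPoly m (∑ i, u i * v i) r := by
  have h0 : gaussFunctional ι B (gaussForm m u v ^ 0) = 1 := by
    rw [pow_zero, ← MvPolynomial.C_1, MvPolynomial.C_apply, gaussFunctional_monomial]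
    simp [gaussMoment]
  induction r using Nat.twoStepInduction with
  | zero => exact h0
  | one =>
    rw [gaussFunctional_gaussForm_pow_succ, h0]
    simp [wickPoly]
  | more r ih1 ih2 =>
    rw [gaussFunctional_gaussForm_pow_succ, ih2, Nat.add_sub_cancel, ih1, wickPoly]

/-- Each Wick polynomial is a polynomial in `Q`, so congruent covariances give congruent moments. -/
theorem wickPoly_sub_mem (I : Ideal B) (m : B) {Q Q' : B} (h : Q - Q' ∈ I) (r : ℕ) :
    wickPoly m Q r - wickPoly m Q' r ∈ I := by
  rw [← Ideal.Quotient.mk_eq_mk_iff_sub_mem] at h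
  induction r using Nat.twoStepInduction with
  | zero => simp [wickPoly]
  | one => simp [wickPoly]
  | more r ih1 ih2 =>
    rw [← Ideal.Quotient.mk_eq_mk_iff_sub_mem] at ih1 ih2 ⊢
    simp only [wickPoly, map_add, map_mul, ih1, ih2, h]

end GaussFunctional

/-! ### The algebraic expectation as an actual integral. -/

section GaussIntegral

variable {N : ℕ}

theorem integrable_and_integral_monomial (p q : Fin N × Fin N → ℕ) :
    Integrable (fun g : Fin N → Fin N → ℂ =>
      ∏ i, ∏ j, (g i j ^ p (i, j) * conj (g i j) ^ q (i, j))) (iidComplexNormal N) ∧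
    ∫ g, ∏ i, ∏ j, (g i j ^ p (i, j) * conj (g i j) ^ q (i, j)) ∂(iidComplexNormal N) =
      ∏ i, ∏ j, if p (i, j) = q (i, j) then ((p (i, j)).factorial : ℂ) else 0 := by
  constructor
  · refine Integrable.fintype_prod_dep (f := fun i (r : Fin N → ℂ) =>
      ∏ j, (r j ^ p (i, j) * conj (r j) ^ q (i, j))) fun i => ?_
    exact Integrable.fintype_prod_dep (f := fun j (w : ℂ) => w ^ p (i, j) * conj w ^ q (i, j))
      fun j => integrable_pow_mul_conj_pow_stdComplexNormal _ _
  · rw [iidComplexNormal, integral_fintype_prod_eq_prod (f := fun i (r : Fin N → ℂ) =>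
      ∏ j, (r j ^ p (i, j) * conj (r j) ^ q (i, j)))]
    refine Finset.prod_congr rfl fun i _ => ?_
    rw [integral_fintype_prod_eq_prod (f := fun j (w : ℂ) => w ^ p (i, j) * conj w ^ q (i, j))]
    exact Finset.prod_congr rfl fun j _ => integral_pow_mul_conj_pow_stdComplexNormal _ _

/-- The evaluation point, in a complex algebra, given by an array and its conjugate. -/
def gaussPoint (B : Type*) [CommRing B] [Algebra ℂ B] (g : Fin N → Fin N → ℂ) :
    (Fin N × Fin N) ⊕ (Fin N × Fin N) → B :=
  Sum.elim (fun p => algebraMap ℂ B (g p.1 p.2)) fun p => algebraMap ℂ B (conj (g p.1 p.2))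

variable {B : Type*} [CommRing B] [Algebra ℂ B]

/-- Allowing coefficients in an algebra `B` and composing with a functional `l` interchanges the
expectation with `detFunctional`, whose argument has random polynomial coefficients. -/
theorem integrable_and_integral_eval (l : B →ₗ[ℂ] ℂ)
    (Y : MvPolynomial ((Fin N × Fin N) ⊕ (Fin N × Fin N)) B) :
    Integrable (fun g => l (MvPolynomial.eval (gaussPoint B g) Y)) (iidComplexNormal N) ∧
    ∫ g, l (MvPolynomial.eval (gaussPoint B g) Y) ∂(iidComplexNormal N) =
      l (gaussFunctional (Fin N × Fin N) B Y) := by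
  induction Y using MvPolynomial.induction_on' with
  | add p q hp hq =>
    simp only [map_add]
    refine ⟨hp.1.add hq.1, ?_⟩
    rw [integral_add hp.1 hq.1, hp.2, hq.2]
  | monomial α b =>
    have h : ∀ g : Fin N → Fin N → ℂ,
        l (MvPolynomial.eval (gaussPoint B g) (MvPolynomial.monomial α b)) = l b *
        ∏ i, ∏ j, (g i j ^ α (Sum.inl (i, j)) * conj (g i j) ^ α (Sum.inr (i, j))) := by
      intro g
      rw [MvPolynomial.eval_monomial, Finsupp.prod_fintype _ _ (by simp), Fintype.prod_sum_type,
        ← Finset.prod_mul_distrib, Fintype.prod_prod_type]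
      simp only [gaussPoint, Sum.elim_inl, Sum.elim_inr]
      simp_rw [← map_pow, ← map_mul, ← map_prod]
      rw [mul_comm, ← Algebra.smul_def, map_smul, smul_eq_mul, mul_comm]
    simp_rw [h]
    obtain ⟨h1, h2⟩ := integrable_and_integral_monomial (fun p => α (Sum.inl p))
      (fun p => α (Sum.inr p))
    refine ⟨h1.const_mul _, ?_⟩
    rw [integral_const_mul, h2, gaussFunctional_monomial, gaussMoment, ← map_natCast (algebraMap ℂ B),
      mul_comm b, ← Algebra.smul_def, map_smul, smul_eq_mul, mul_comm, Fintype.prod_prod_type]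
    push_cast
    rfl

end GaussIntegral

/-! ### Expected determinants of Gaussian matrices. -/

section GaussDet

variable {n : Type*} [Fintype n] {N : ℕ}

/-- A random matrix which is an affine form in the entries of an array. -/
def affineMatrix (M : Matrix n n ℂ) (U V : Fin N × Fin N → Matrix n n ℂ)
    (g : Fin N → Fin N → ℂ) : Matrix n n ℂ :=
  M + ∑ p : Fin N × Fin N, (g p.1 p.2 • U p + conj (g p.1 p.2) • V p)

theorem linearFormOfMatrix_add (A A' : Matrix n n ℂ) :
    linearFormOfMatrix (A + A') = linearFormOfMatrix A + linearFormOfMatrix A' := by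
  simp [linearFormOfMatrix, add_mul, Finset.sum_add_distrib]

theorem linearFormOfMatrix_smul (c : ℂ) (A : Matrix n n ℂ) :
    linearFormOfMatrix (c • A) = MvPolynomial.C c * linearFormOfMatrix A := by
  simp [linearFormOfMatrix, Finset.mul_sum, mul_assoc]

theorem linearFormOfMatrix_sum {κ : Type*} (s : Finset κ) (A : κ → Matrix n n ℂ) :
    linearFormOfMatrix (∑ i ∈ s, A i) = ∑ i ∈ s, linearFormOfMatrix (A i) := by
  classical
  induction s using Finset.induction_on with
  | empty => simp [linearFormOfMatrix]
  | insert a s ha ih => rw [Finset.sum_insert ha, Finset.sum_insert ha, linearFormOfMatrix_add, ih]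

/-- The expected determinant of a Gaussian matrix, in terms of its covariance. -/
theorem integral_det_affineMatrix [DecidableEq n] (M : Matrix n n ℂ) (U V : Fin N × Fin N → Matrix n n ℂ) :
    (Fintype.card n).factorial * ∫ g, (affineMatrix M U V g).det ∂(iidComplexNormal N) =
      detFunctional n (wickPoly (linearFormOfMatrix M)
        (∑ p, linearFormOfMatrix (U p) * linearFormOfMatrix (V p)) (Fintype.card n)) := by
  rw [← gaussFunctional_gaussForm_pow, ← (integrable_and_integral_eval _ _).2, ← integral_const_mul]
  refine integral_congr_ae (ae_of_all _ fun g => ?_)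
  simp only
  rw [← detFunctional_linearForm_pow,
    map_pow (MvPolynomial.eval (gaussPoint (MvPolynomial (n × n) ℂ) g))]
  congr 2
  simp only [affineMatrix, linearFormOfMatrix_add, linearFormOfMatrix_smul, gaussForm,
    linearFormOfMatrix_sum]
  simp [gaussPoint, MvPolynomial.algebraMap_eq, mul_comm]

end GaussDet

/-! ### Duality between sizes `N` and `k`. -/

section Duality

variable (N k : ℕ)

/-- The index type of the block matrices in the duality formula. -/
abbrev DualIndex : Type := Fin N × (Fin k ⊕ Fin k)

/-- The deterministic part `diag (-z, -conj z)`. -/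
def dualMean (z : ℂ) : Matrix (DualIndex N k) (DualIndex N k) ℂ :=
  Matrix.diagonal fun x => Sum.elim (fun _ => -z) (fun _ => -conj z) x.2

variable {N k}

/-- `dualU` and `dualV` are the coefficients of an entry and of its conjugate in the block diagonal
matrix made of `k` copies of `c G - z` (indices `inl`) and `k` copies of its adjoint (indices
`inr`). -/
def dualU (c : ℂ) (p : Fin N × Fin N) : Matrix (DualIndex N k) (DualIndex N k) ℂ :=
  c • ∑ a : Fin k, Matrix.single (p.1, Sum.inl a) (p.2, Sum.inl a) 1

def dualV (c : ℂ) (p : Fin N × Fin N) : Matrix (DualIndex N k) (DualIndex N k) ℂ :=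
  c • ∑ b : Fin k, Matrix.single (p.2, Sum.inr b) (p.1, Sum.inr b) 1

/-- The dual family couples `inl` to `inr`, identically for all `N` values of the first index. The
minus sign in `dualV'` compensates the sign of the antisymmetry relation. -/
def dualU' (c : ℂ) (q : Fin k × Fin k) : Matrix (DualIndex N k) (DualIndex N k) ℂ :=
  c • ∑ i : Fin N, Matrix.single (i, Sum.inl q.1) (i, Sum.inr q.2) 1

def dualV' (c : ℂ) (q : Fin k × Fin k) : Matrix (DualIndex N k) (DualIndex N k) ℂ :=
  (-c) • ∑ j : Fin N, Matrix.single (j, Sum.inr q.2) (j, Sum.inl q.1) 1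

theorem linearFormOfMatrix_single {n : Type*} [Fintype n] [DecidableEq n] (x y : n) :
    linearFormOfMatrix (Matrix.single x y (1 : ℂ)) = MvPolynomial.X (x, y) := by
  rw [linearFormOfMatrix, Finset.sum_eq_single (x, y)]
  · simp
  · rintro ⟨a, b⟩ _ h
    rw [Matrix.single_apply_of_ne]
    · simp
    · rintro ⟨rfl, rfl⟩; exact h rfl
  · simp

theorem sum_mul_sum_sub_sum_mul_sum {R α β : Type*} [CommRing R] [Fintype α] [Fintype β] (c : R)
    (A B : α × α → β → R) (C D : β × β → α → R) :
    (∑ p, (c * ∑ a, A p a) * (c * ∑ b, B p b)) - (∑ q, (c * ∑ i, C q i) * (-c * ∑ j, D q j)) =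
      c * c * ∑ p : α × α, ∑ q : β × β, (A p q.1 * B p q.2 + C q p.1 * D q p.2) := by
  simp only [Finset.sum_add_distrib, mul_add]
  rw [Finset.sum_comm (f := fun (p : α × α) (q : β × β) => C q p.1 * D q p.2), sub_eq_add_neg,
    ← Finset.sum_neg_distrib, Finset.mul_sum, Finset.mul_sum]
  congr 1
  · refine Finset.sum_congr rfl fun p _ => ?_
    rw [Fintype.sum_prod_type, mul_mul_mul_comm, Finset.sum_mul_sum]
  · refine Finset.sum_congr rfl fun q _ => ?_
    rw [Fintype.sum_prod_type, mul_mul_mul_comm, Finset.sum_mul_sum]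
    ring

/-- Term by term, the difference is an antisymmetry relation: with rows `(p.1, inl a)` and `(p.2,
inr b)`, the first covariance pairs them with columns `(p.2, inl a)` and `(p.1, inr b)`, the dual
one with the same columns exchanged. -/
theorem dual_covariance_sub_mem (c : ℂ) :
    (∑ p : Fin N × Fin N, linearFormOfMatrix (dualU (k := k) c p) *
        linearFormOfMatrix (dualV (k := k) c p)) -
      (∑ q : Fin k × Fin k, linearFormOfMatrix (dualU' (N := N) c q) *
        linearFormOfMatrix (dualV' (N := N) c q)) ∈ detIdeal (DualIndex N k) := by
  simp only [dualU, dualV, dualU', dualV', linearFormOfMatrix_smul, linearFormOfMatrix_sum,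
    linearFormOfMatrix_single, map_neg]
  rw [sum_mul_sum_sub_sum_mul_sum (MvPolynomial.C c)
    (fun (p : Fin N × Fin N) (a : Fin k) =>
      (MvPolynomial.X ((p.1, Sum.inl a), (p.2, Sum.inl a)) :
        MvPolynomial (DualIndex N k × DualIndex N k) ℂ))
    (fun p b => MvPolynomial.X ((p.2, Sum.inr b), (p.1, Sum.inr b)))
    (fun q i => MvPolynomial.X ((i, Sum.inl q.1), (i, Sum.inr q.2)))
    (fun q j => MvPolynomial.X ((j, Sum.inr q.2), (j, Sum.inl q.1)))]
  exact Ideal.mul_mem_left _ _ (Ideal.sum_mem _ fun p _ => Ideal.sum_mem _ fun q _ =>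
    relation_mem_detIdeal _ _ _ _)

theorem affineMatrix_dual (c z : ℂ) (g : Fin N → Fin N → ℂ) :
    affineMatrix (dualMean N k z) (dualU c) (dualV c) g =
      Matrix.blockDiagonal (Sum.elim (fun _ : Fin k => c • Matrix.of g - z • 1)
        (fun _ : Fin k => c • (Matrix.of g).conjTranspose - conj z • 1)) := by
  ext ⟨i, x⟩ ⟨j, y⟩
  simp only [affineMatrix, dualMean, dualU, dualV, Matrix.add_apply, Matrix.sum_apply,
    Matrix.smul_apply, Matrix.single_apply, Matrix.blockDiagonal_apply, Matrix.diagonal_apply,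
    Fintype.sum_prod_type]
  rcases x with a | a <;> rcases y with b | b
  · by_cases hab : a = b
    · subst hab
      simp [Matrix.one_apply, Finset.sum_ite_eq', ite_and, Matrix.sub_apply]
      split_ifs <;> ring
    · simp [hab, ite_and]
  · simp
  · simp
  · by_cases hab : a = b
    · subst hab
      simp [Matrix.one_apply, Finset.sum_ite_eq', ite_and, Matrix.sub_apply]
      split_ifs <;> ring
    · simp [hab, ite_and]

theorem affineMatrix_dual' (c z : ℂ) (w : Fin k → Fin k → ℂ) :
    affineMatrix (dualMean N k z) (dualU' c) (dualV' c) w =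
      (Matrix.blockDiagonal (fun _ : Fin N => Matrix.fromBlocks (-z • 1) (c • Matrix.of w)
        (-c • (Matrix.of w).conjTranspose) (-conj z • 1))).submatrix Prod.swap Prod.swap := by
  ext ⟨i, x⟩ ⟨j, y⟩
  simp only [affineMatrix, dualMean, dualU', dualV', Matrix.add_apply, Matrix.sum_apply,
    Matrix.smul_apply, Matrix.single_apply, Matrix.blockDiagonal_apply, Matrix.diagonal_apply,
    Fintype.sum_prod_type, Matrix.submatrix_apply, Prod.swap]
  by_cases hij : i = j
  · subst hij
    rcases x with a | a <;> rcases y with b | b <;>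
      simp [Matrix.one_apply, ite_and, neg_ite, mul_comm]
  · rcases x with a | a <;> rcases y with b | b <;>
      simp [hij, ite_and]

/-- For `z ≠ 0` the lower right block is invertible and the Schur complement applies; both sides are
continuous in `z`, which covers `z = 0`. -/
theorem det_fromBlocks_dual (c : ℝ) (z : ℂ) (W : Matrix (Fin k) (Fin k) ℂ) :
    (Matrix.fromBlocks (-z • 1) ((c : ℂ) • W) (-(c : ℂ) • W.conjTranspose) (-conj z • 1)).det =
      ((‖z‖ ^ 2 : ℝ) • (1 : Matrix (Fin k) (Fin k) ℂ) +
        (c ^ 2 : ℝ) • (W * W.conjTranspose)).det := by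
  have hc : ∀ z : ℂ, z ≠ 0 →
      (Matrix.fromBlocks (-z • 1) ((c : ℂ) • W) (-(c : ℂ) • W.conjTranspose) (-conj z • 1)).det =
      ((‖z‖ ^ 2 : ℝ) • (1 : Matrix (Fin k) (Fin k) ℂ) +
        (c ^ 2 : ℝ) • (W * W.conjTranspose)).det := by
    intro z hz
    have hz' : conj z ≠ 0 := by simpa using hz
    let D : Matrix (Fin k) (Fin k) ℂ := -conj z • 1
    let _ : Invertible D := ⟨(-conj z)⁻¹ • 1, by simp [D, smul_smul, hz], by simp [D, smul_smul, hz]⟩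
    have hinv : ⅟D = (-conj z)⁻¹ • 1 := rfl
    change (Matrix.fromBlocks _ _ _ D).det = _
    rw [Matrix.det_fromBlocks₂₂, ← Matrix.det_mul, hinv]
    congr 1
    have hn : ((‖z‖ ^ 2 : ℝ) : ℂ) = z * conj z := by
      rw [Complex.mul_conj, Complex.normSq_eq_norm_sq]
    ext i j
    simp only [D, Matrix.smul_mul, Matrix.mul_smul, Matrix.one_mul, Matrix.mul_one,
      Matrix.smul_apply, Matrix.sub_apply, Matrix.add_apply, smul_eq_mul, Complex.real_smul, hn]
    push_cast
    field_simp
    ring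
  refine congr_fun (Continuous.ext_on (dense_compl_singleton (0 : ℂ)) ?_ ?_ fun z hz => hc z hz) z
  · refine Continuous.matrix_det (Continuous.matrix_fromBlocks ?_ ?_ ?_ ?_) <;> fun_prop
  · exact Continuous.matrix_det (by fun_prop)

/-- Duality between the moments of the characteristic polynomial of a Gaussian matrix of size `N`
and averages over a Gaussian matrix of size `k`. -/
theorem integral_norm_det_pow_eq (N k : ℕ) (c : ℝ) (z : ℂ) :
    ((∫ g, ‖((c : ℂ) • Matrix.of g - z • (1 : Matrix (Fin N) (Fin N) ℂ)).det‖ ^ (2 * k)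
      ∂(iidComplexNormal N) : ℝ) : ℂ) =
    ∫ w, ((‖z‖ ^ 2 : ℝ) • (1 : Matrix (Fin k) (Fin k) ℂ) +
        (c ^ 2 : ℝ) • (Matrix.of w * (Matrix.of w).conjTranspose)).det ^ N
      ∂(iidComplexNormal k) := by
  have hf : ((Fintype.card (DualIndex N k)).factorial : ℂ) ≠ 0 := by
    exact_mod_cast Nat.factorial_ne_zero _
  have h : ∫ g, (affineMatrix (dualMean N k z) (dualU (c : ℂ)) (dualV c) g).det
        ∂(iidComplexNormal N) =
      ∫ w, (affineMatrix (dualMean N k z) (dualU' (c : ℂ)) (dualV' c) w).det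
        ∂(iidComplexNormal k) := by
    refine mul_left_cancel₀ hf ?_
    rw [integral_det_affineMatrix, integral_det_affineMatrix]
    exact detFunctional_eq_of_sub_mem (wickPoly_sub_mem _ _ (dual_covariance_sub_mem _) _)
  rw [← integral_complex_ofReal]
  refine Eq.trans (integral_congr_ae (ae_of_all _ fun g => ?_))
    (h.trans (integral_congr_ae (ae_of_all _ fun w => ?_)))
  · simp only
    rw [affineMatrix_dual, Matrix.det_blockDiagonal, Fintype.prod_sum_type]
    simp only [Sum.elim_inl, Sum.elim_inr, Finset.prod_const, Finset.card_univ, Fintype.card_fin]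
    have : (c : ℂ) • (Matrix.of g).conjTranspose - conj z • (1 : Matrix (Fin N) (Fin N) ℂ) =
        ((c : ℂ) • Matrix.of g - z • (1 : Matrix (Fin N) (Fin N) ℂ)).conjTranspose := by
      rw [Matrix.conjTranspose_sub, Matrix.conjTranspose_smul, Matrix.conjTranspose_smul,
        Matrix.conjTranspose_one]
      simp
    rw [this, Matrix.det_conjTranspose, ← mul_pow, ← starRingEnd_apply, Complex.mul_conj,
      Complex.normSq_eq_norm_sq]
    push_cast
    rw [pow_mul]
  · simp only
    rw [affineMatrix_dual']
    have := Matrix.det_submatrix_equiv_self (Equiv.prodComm (Fin N) (Fin k ⊕ Fin k))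
      (Matrix.blockDiagonal (fun _ : Fin N => Matrix.fromBlocks (-z • 1) ((c : ℂ) • Matrix.of w)
        (-(c : ℂ) • (Matrix.of w).conjTranspose) (-conj z • 1)))
    rw [Equiv.coe_prodComm] at this
    rw [this, Matrix.det_blockDiagonal, Finset.prod_const, Finset.card_univ, Fintype.card_fin,
      det_fromBlocks_dual]

end Duality

/-! ### Radial integration on complex coordinate space. -/

theorem lintegral_Ioi_comp_sq (f : ℝ → ℝ≥0∞) :
    ∫⁻ r in Set.Ioi (0 : ℝ), ENNReal.ofReal (2 * r) * f (r ^ 2) = ∫⁻ s in Set.Ioi (0 : ℝ), f s := by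
  have himg : (fun r : ℝ => r ^ 2) '' Set.Ioi 0 = Set.Ioi 0 := by
    ext s
    constructor
    · rintro ⟨r, hr, rfl⟩
      exact pow_pos (Set.mem_Ioi.1 hr) 2
    · intro hs
      exact ⟨Real.sqrt s, Real.sqrt_pos.2 hs, Real.sq_sqrt (le_of_lt hs)⟩
  have h := lintegral_image_eq_lintegral_abs_deriv_mul (s := Set.Ioi (0 : ℝ)) measurableSet_Ioi
    (f := fun r => r ^ 2) (f' := fun r => 2 * r)
    (fun x _ => by simpa using (hasDerivAt_pow 2 x).hasDerivWithinAt)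
    (fun a ha b hb hab => (pow_left_inj₀ (le_of_lt ha) (le_of_lt hb) two_ne_zero).1 hab) f
  rw [himg] at h
  rw [h]
  refine setLIntegral_congr_fun measurableSet_Ioi fun r hr => ?_
  have hr' : (0 : ℝ) < r := hr
  rw [abs_of_pos (by positivity : (0 : ℝ) < 2 * r)]

theorem lintegral_comp_norm_sq (f : ℝ → ℝ≥0∞) (hf : Measurable f) :
    ∫⁻ w : ℂ, f (‖w‖ ^ 2) = ENNReal.ofReal Real.pi * ∫⁻ s in Set.Ioi (0 : ℝ), f s := by
  rw [← Complex.lintegral_comp_polarCoord_symm, polarCoord_target, Measure.volume_eq_prod,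
    ← Measure.prod_restrict]
  have hg : Measurable fun r : ℝ => ENNReal.ofReal r * f (r ^ 2) := by fun_prop
  rw [lintegral_prod]
  · have : ∀ r ∈ Set.Ioi (0 : ℝ), (∫⁻ θ in Set.Ioo (-Real.pi) Real.pi,
        ENNReal.ofReal (r, θ).1 • f (‖Complex.polarCoord.symm (r, θ)‖ ^ 2)) =
        ENNReal.ofReal Real.pi * (ENNReal.ofReal (2 * r) * f (r ^ 2)) := by
      intro r hr
      simp only [Complex.norm_polarCoord_symm, sq_abs, smul_eq_mul, lintegral_const,
        Measure.restrict_apply MeasurableSet.univ, Set.univ_inter, Real.volume_Ioo]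
      rw [show Real.pi - -Real.pi = 2 * Real.pi by ring, ENNReal.ofReal_mul zero_le_two,
        ENNReal.ofReal_mul zero_le_two]
      ring
    rw [setLIntegral_congr_fun measurableSet_Ioi this, lintegral_const_mul' _ _ ENNReal.ofReal_ne_top,
      lintegral_Ioi_comp_sq]
  · simp only [Complex.norm_polarCoord_symm, sq_abs]
    exact (hg.comp measurable_fst).aemeasurable

theorem lintegral_pow_Ioo (k : ℕ) (r : ℝ) (hr : 0 ≤ r) :
    ∫⁻ s in Set.Ioo 0 r, ENNReal.ofReal (s ^ k) = ENNReal.ofReal (r ^ (k + 1) / (k + 1)) := by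
  rw [← ofReal_integral_eq_lintegral_ofReal]
  · rw [← integral_Ioc_eq_integral_Ioo, ← intervalIntegral.integral_of_le hr, integral_pow]
    simp
  · exact ((continuous_pow k).integrableOn_Icc (a := 0) (b := r)).mono_set Set.Ioo_subset_Icc_self
  · refine (ae_restrict_iff' measurableSet_Ioo).2 (ae_of_all _ fun s hs => ?_)
    exact pow_nonneg hs.1.le k

/-- Integration of radial functions on `ℂ^(k+1)`. -/
theorem lintegral_comp_sum_norm_sq (k : ℕ) (f : ℝ → ℝ≥0∞) (hf : Measurable f) :
    ∫⁻ w : Fin (k + 1) → ℂ, f (∑ i, ‖w i‖ ^ 2) =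
      ENNReal.ofReal (Real.pi ^ (k + 1) / k.factorial) *
        ∫⁻ s in Set.Ioi (0 : ℝ), ENNReal.ofReal (s ^ k) * f s := by
  induction k generalizing f with
  | zero =>
    have h := lintegral_pi_fin_succ (volume : Measure ℂ) 0
      (fun w : Fin 1 → ℂ => f (∑ i, ‖w i‖ ^ 2)) (by fun_prop)
    rw [volume_pi, h]
    simp [lintegral_comp_norm_sq f hf, Measure.pi_of_empty _ Fin.elim0]
  | succ k ih =>
    have h := lintegral_pi_fin_succ (volume : Measure ℂ) (k + 1)
      (fun w : Fin (k + 2) → ℂ => f (∑ i, ‖w i‖ ^ 2)) (by fun_prop)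
    rw [volume_pi, h]
    have h1 : ∀ a : ℂ, ∫⁻ b : Fin (k + 1) → ℂ,
        f (∑ i, ‖(Fin.cons a b : Fin (k + 2) → ℂ) i‖ ^ 2) ∂(Measure.pi fun _ => volume) =
        ENNReal.ofReal (Real.pi ^ (k + 1) / k.factorial) *
        ∫⁻ s in Set.Ioi (0 : ℝ), ENNReal.ofReal (s ^ k) * f (‖a‖ ^ 2 + s) := by
      intro a
      rw [← ih (fun s => f (‖a‖ ^ 2 + s)) (by fun_prop), volume_pi]
      simp [Fin.sum_univ_succ]
    simp_rw [h1]
    rw [lintegral_const_mul' _ _ ENNReal.ofReal_ne_top]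
    have hG : Measurable fun t : ℝ => ∫⁻ s in Set.Ioi (0 : ℝ), ENNReal.ofReal (s ^ k) * f (t + s) :=
      Measurable.lintegral_prod_right' (f := fun p : ℝ × ℝ => ENNReal.ofReal (p.2 ^ k) * f (p.1 + p.2))
        (by fun_prop)
    rw [lintegral_comp_norm_sq _ hG, lintegral_lintegral_swap (by fun_prop)]
    -- With `r = t + s` the domain becomes `0 < s < r`; integrating `s ^ k` first then gives `r ^ (k
    -- + 1) / (k + 1)`.
    have h2 : ∀ s : ℝ, ∫⁻ t in Set.Ioi (0 : ℝ), ENNReal.ofReal (s ^ k) * f (t + s) =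
        ∫⁻ r, if s < r then ENNReal.ofReal (s ^ k) * f r else 0 := by
      intro s
      rw [← lintegral_indicator measurableSet_Ioi,
        ← lintegral_add_right_eq_self (fun r => if s < r then ENNReal.ofReal (s ^ k) * f r else 0) s]
      refine lintegral_congr fun t => ?_
      simp [Set.indicator_apply]
    have h3 : ∀ r : ℝ, ∫⁻ s in Set.Ioi (0 : ℝ),
        (if s < r then ENNReal.ofReal (s ^ k) * f r else 0) =
        (Set.Ioi (0 : ℝ)).indicator (fun r => ENNReal.ofReal (r ^ (k + 1) / (k + 1)) * f r) r := by
      intro r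
      have e : ∀ s : ℝ, (if s < r then ENNReal.ofReal (s ^ k) * f r else 0) =
          (Set.Iio r).indicator (fun s => ENNReal.ofReal (s ^ k) * f r) s := by
        intro s; simp [Set.indicator_apply]
      simp_rw [e]
      rw [setLIntegral_indicator measurableSet_Iio, Set.inter_comm, Set.Ioi_inter_Iio,
        lintegral_mul_const _ (by fun_prop)]
      rcases lt_or_ge 0 r with hr | hr
      · rw [lintegral_pow_Ioo k r hr.le, Set.indicator_of_mem (Set.mem_Ioi.2 hr)]
      · rw [Set.Ioo_eq_empty (not_lt.2 hr), Set.indicator_of_notMem (by simpa using hr)]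
        simp
    simp_rw [h2]
    rw [lintegral_lintegral_swap]
    · simp_rw [h3]
      rw [lintegral_indicator measurableSet_Ioi, ← mul_assoc,
        ← ENNReal.ofReal_mul (by positivity), ← lintegral_const_mul' _ _ ENNReal.ofReal_ne_top,
        ← lintegral_const_mul' _ _ ENNReal.ofReal_ne_top]
      refine setLIntegral_congr_fun measurableSet_Ioi fun r hr => ?_
      have hr' : (0 : ℝ) < r := hr
      rw [← mul_assoc, ← mul_assoc, ← ENNReal.ofReal_mul (by positivity),
        ← ENNReal.ofReal_mul (by positivity), Nat.factorial_succ]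
      congr 2
      push_cast
      have : (k.factorial : ℝ) ≠ 0 := by exact_mod_cast k.factorial_ne_zero
      field_simp
      ring
    · refine (Measurable.ite (measurableSet_lt measurable_fst measurable_snd) ?_
        measurable_const).aemeasurable
      fun_prop

/-! ### Unitary invariance of Lebesgue measure. -/

section Unitary

/-- A linear automorphism which preserves a set of finite positive volume is measure preserving. -/
theorem measurePreserving_of_preimage_eq {E : Type*} [NormedAddCommGroup E] [NormedSpace ℝ E]
    [FiniteDimensional ℝ E] [MeasurableSpace E] [BorelSpace E] (μ : Measure E) [μ.IsAddHaarMeasure]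
    (f : E →ₗ[ℝ] E) (hf : Function.Injective f) (s : Set E) (hs : MeasurableSet s) (h0 : μ s ≠ 0)
    (h1 : μ s ≠ ∞) (h : f ⁻¹' s = s) : MeasurePreserving f μ μ := by
  have hdet : LinearMap.det f ≠ 0 :=
    ((LinearMap.isUnit_iff_ker_eq_bot f).2 (LinearMap.ker_eq_bot.2 hf)).map LinearMap.det |>.ne_zero
  have hmap := Measure.map_linearMap_addHaar_eq_smul_addHaar μ hdet
  have hm : Measurable f := f.continuous_of_finiteDimensional.measurable
  refine ⟨hm, ?_⟩
  have h2 := congrArg (fun ν : Measure E => ν s) hmap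
  simp only [Measure.map_apply hm hs, h, Measure.smul_apply, smul_eq_mul] at h2
  have h3 : ENNReal.ofReal |(LinearMap.det f)⁻¹| = 1 := by
    have : 1 * μ s = ENNReal.ofReal |(LinearMap.det f)⁻¹| * μ s := by rw [one_mul]; exact h2
    exact ((ENNReal.mul_left_inj h0 h1).1 this).symm
  rw [hmap, h3, one_smul]

-- The invariant set is the Euclidean unit ball, written as a sum of squares because the ambient
-- norm on `n → ℂ` is the sup norm.
open Matrix in
theorem measurePreserving_vecMul_unitary {n : Type*} [Fintype n] [DecidableEq n]
    (U : Matrix n n ℂ) (hU : U * Uᴴ = 1) :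
    MeasurePreserving (fun v : n → ℂ => v ᵥ* U) := by
  have hnorm : ∀ v : n → ℂ, ∑ i, ‖(v ᵥ* U) i‖ ^ 2 = ∑ i, ‖v i‖ ^ 2 := by
    intro v
    have e : ∀ v : n → ℂ, ((∑ i, ‖v i‖ ^ 2 : ℝ) : ℂ) = v ⬝ᵥ star v := by
      intro v
      simp [dotProduct, Complex.mul_conj, Complex.normSq_eq_norm_sq]
    have : ((∑ i, ‖(v ᵥ* U) i‖ ^ 2 : ℝ) : ℂ) = ((∑ i, ‖v i‖ ^ 2 : ℝ) : ℂ) := by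
      rw [e, e, star_vecMul, ← dotProduct_mulVec, mulVec_mulVec, hU, one_mulVec]
    exact_mod_cast this
  let f : (n → ℂ) →ₗ[ℝ] (n → ℂ) := (Matrix.vecMulLinear U).restrictScalars ℝ
  let s : Set (n → ℂ) := {v | ∑ i, ‖v i‖ ^ 2 < 1}
  have hc : Continuous fun v : n → ℂ => ∑ i, ‖v i‖ ^ 2 := by fun_prop
  have ho : IsOpen s := isOpen_lt hc continuous_const
  have hinj : Function.Injective f := by
    intro v w h
    have h' : v ᵥ* U = w ᵥ* U := h
    have := congrArg (fun x => x ᵥ* Uᴴ) h'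
    simpa [vecMul_vecMul, hU] using this
  have hsub : s ⊆ Metric.closedBall 0 1 := by
    intro v hv
    rw [mem_closedBall_zero_iff, pi_norm_le_iff_of_nonneg zero_le_one]
    intro i
    have h1 : ‖v i‖ ^ 2 ≤ ∑ i, ‖v i‖ ^ 2 :=
      Finset.single_le_sum (f := fun i => ‖v i‖ ^ 2) (fun _ _ => by positivity) (Finset.mem_univ i)
    have h2 : ‖v i‖ ^ 2 < 1 := lt_of_le_of_lt h1 hv
    exact le_of_lt (by simpa using (sq_lt_one_iff₀ (norm_nonneg _)).1 h2)
  refine measurePreserving_of_preimage_eq volume f hinj s ho.measurableSet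
    (ho.measure_pos volume ⟨0, by simp [s]⟩).ne'
    ((measure_mono hsub).trans_lt measure_closedBall_lt_top).ne ?_
  ext v
  change ∑ i, ‖(v ᵥ* U) i‖ ^ 2 < 1 ↔ ∑ i, ‖v i‖ ^ 2 < 1
  rw [hnorm]

open Matrix in
/-- Every vector can be rotated to a multiple of the first basis vector. -/
theorem exists_unitary_vecMul_eq {k : ℕ} (w : Fin (k + 1) → ℂ) :
    ∃ U : Matrix (Fin (k + 1)) (Fin (k + 1)) ℂ, U * Uᴴ = 1 ∧
      w ᵥ* U = Pi.single 0 ((Real.sqrt (∑ i, ‖w i‖ ^ 2) : ℝ) : ℂ) := by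
  rcases eq_or_ne w 0 with rfl | hw
  · exact ⟨1, by simp, by simp⟩
  let x : EuclideanSpace ℂ (Fin (k + 1)) := WithLp.toLp 2 w
  have hx : x ≠ 0 := fun h => hw (by simpa [x] using h)
  have hxn : ‖x‖ = Real.sqrt (∑ i, ‖w i‖ ^ 2) := by
    rw [EuclideanSpace.norm_eq]
  have hx0 : (‖x‖ : ℂ) ≠ 0 := by exact_mod_cast norm_ne_zero_iff.2 hx
  -- Only index `0` is prescribed, so a constant family restricted to `{0}` suffices for the
  -- extension to an orthonormal basis.
  let v : Fin (k + 1) → EuclideanSpace ℂ (Fin (k + 1)) := fun _ => (‖x‖ : ℂ)⁻¹ • x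
  have hv : Orthonormal ℂ (({0} : Set (Fin (k + 1))).domRestrict v) := by
    refine ⟨fun i => norm_smul_inv_norm hx, fun i j hij => absurd (Subtype.ext ?_) hij⟩
    rw [Set.mem_singleton_iff.1 i.2, Set.mem_singleton_iff.1 j.2]
  obtain ⟨b, hb⟩ := hv.exists_orthonormalBasis_extension_of_card_eq (by simp)
  have hb0 : b 0 = (‖x‖ : ℂ)⁻¹ • x := hb 0 rfl
  have hxb : x = (‖x‖ : ℂ) • b 0 := by rw [hb0, smul_smul, mul_inv_cancel₀ hx0, one_smul]
  refine ⟨Matrix.of fun i j => conj (b j i), ?_, ?_⟩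
  · rw [mul_eq_one_comm]
    ext i j
    have := b.inner_eq_ite j i
    rw [PiLp.inner_apply] at this
    simp only [Matrix.mul_apply, Matrix.conjTranspose_apply, Matrix.of_apply, Matrix.one_apply]
    simp only [eq_comm (a := i), ← this]
    refine Finset.sum_congr rfl fun l _ => ?_
    simp
  · ext j
    have h1 : inner ℂ (b j) x = if j = 0 then (‖x‖ : ℂ) else 0 := by
      rw [hxb, inner_smul_right, b.inner_eq_ite]
      simp [← hxb]
    rw [PiLp.inner_apply] at h1
    rw [← hxn, Pi.single_apply, ← h1, vecMul, dotProduct]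
    refine Finset.sum_congr rfl fun l _ => ?_
    simp [x]

end Unitary

/-! ### Positivity of bordered matrices. -/

section Bordered

open Matrix
open scoped ComplexOrder

/-- The matrix obtained from `H` by adding a first row `(s, v)` and a first column `(s, conj v)`. -/
def borderedMatrix {k : ℕ} (s : ℝ) (v : Fin k → ℂ) (H : Matrix (Fin k) (Fin k) ℂ) :
    Matrix (Fin (k + 1)) (Fin (k + 1)) ℂ :=
  Matrix.of (Fin.cons (Fin.cons (s : ℂ) v) fun i => Fin.cons (conj (v i)) (H i))

variable {k : ℕ} (s : ℝ) (v : Fin k → ℂ) (H : Matrix (Fin k) (Fin k) ℂ)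

@[simp] theorem borderedMatrix_zero_zero : borderedMatrix s v H 0 0 = s := rfl
@[simp] theorem borderedMatrix_zero_succ (j : Fin k) : borderedMatrix s v H 0 j.succ = v j := rfl
@[simp] theorem borderedMatrix_succ_zero (i : Fin k) :
    borderedMatrix s v H i.succ 0 = conj (v i) := rfl
@[simp] theorem borderedMatrix_succ_succ (i j : Fin k) :
    borderedMatrix s v H i.succ j.succ = H i j := rfl

/-- The Schur complement of a bordered matrix. -/
theorem dotProduct_borderedMatrix_mulVec (hs : s ≠ 0) (x : Fin (k + 1) → ℂ) :
    star x ⬝ᵥ (borderedMatrix s v H *ᵥ x) =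
      ((s * ‖x 0 + (s : ℂ)⁻¹ * (v ⬝ᵥ fun i => x i.succ)‖ ^ 2 : ℝ) : ℂ) +
      star (fun i => x i.succ) ⬝ᵥ ((H - (s : ℂ)⁻¹ • vecMulVec (star v) v) *ᵥ fun i => x i.succ) := by
  have hs' : (s : ℂ) ≠ 0 := by exact_mod_cast hs
  set y : Fin k → ℂ := fun i => x i.succ
  set t := v ⬝ᵥ y
  have ht : star y ⬝ᵥ star v = conj t := by
    simp [t, dotProduct, mul_comm]
  have e1 : star x ⬝ᵥ (borderedMatrix s v H *ᵥ x) =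
      conj (x 0) * (s * x 0 + t) + (star y ⬝ᵥ star v) * x 0 + star y ⬝ᵥ (H *ᵥ y) := by
    rw [dotProduct, Fin.sum_univ_succ]
    simp only [mulVec, dotProduct, Fin.sum_univ_succ, borderedMatrix_zero_zero,
      borderedMatrix_zero_succ, borderedMatrix_succ_zero, borderedMatrix_succ_succ, mul_add,
      Finset.sum_add_distrib, t, y, Pi.star_apply, Finset.sum_mul, RCLike.star_def]
    simp only [mul_assoc]
    ring
  have e2 : star y ⬝ᵥ ((H - (s : ℂ)⁻¹ • vecMulVec (star v) v) *ᵥ y) =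
      star y ⬝ᵥ (H *ᵥ y) - (s : ℂ)⁻¹ * (conj t * t) := by
    rw [sub_mulVec, dotProduct_sub, smul_mulVec, dotProduct_smul, vecMulVec_mulVec]
    simp only [op_smul_eq_smul, dotProduct_smul, smul_eq_mul, ht]
    ring
  rw [e1, e2, ht]
  push_cast
  rw [← Complex.mul_conj', map_add, map_mul, map_inv₀, Complex.conj_ofReal]
  field_simp
  ring

theorem isHermitian_borderedMatrix_iff : (borderedMatrix s v H).IsHermitian ↔ H.IsHermitian := by
  constructor
  · intro h
    ext i j
    simpa using congr_fun₂ h i.succ j.succ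
  · intro h
    ext i j
    refine Fin.cases ?_ (fun i => ?_) i <;> refine Fin.cases ?_ (fun j => ?_) j
    · simp
    · simp
    · simp
    · simpa using congr_fun₂ h i j

theorem posDef_borderedMatrix_iff : (borderedMatrix s v H).PosDef ↔
    0 < s ∧ (H - (s : ℂ)⁻¹ • vecMulVec (star v) v).PosDef := by
  have hV : ((s : ℂ)⁻¹ • vecMulVec (star v) v).IsHermitian := by
    ext i j
    simp [vecMulVec_apply, mul_comm]
  rw [posDef_iff_dotProduct_mulVec, posDef_iff_dotProduct_mulVec, isHermitian_borderedMatrix_iff]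
  constructor
  · rintro ⟨hH, h⟩
    have hs : 0 < s := by
      have := h (x := Pi.single 0 1) (by simp)
      simpa using this
    refine ⟨hs, hH.sub hV, fun y hy => ?_⟩
    -- The first coordinate is chosen so that the completed square vanishes, leaving only the Schur
    -- complement.
    have := h (x := Fin.cons (-((s : ℂ)⁻¹ * (v ⬝ᵥ y))) y) (fun h0 => hy (by
      ext i; simpa using congr_fun h0 i.succ))
    rw [dotProduct_borderedMatrix_mulVec _ _ _ hs.ne'] at this
    simpa using this
  · rintro ⟨hs, hH, h⟩
    refine ⟨by simpa using hH.add hV, fun x hx => ?_⟩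
    rw [dotProduct_borderedMatrix_mulVec _ _ _ hs.ne']
    by_cases hy : (fun i => x (Fin.succ i)) = 0
    · rw [hy]
      have hx0 : x 0 ≠ 0 := by
        intro h0
        apply hx
        ext i
        exact Fin.cases h0 (fun i => congr_fun hy i) i
      have h0 : (0 : ℂ) < ((s * ‖x 0‖ ^ 2 : ℝ) : ℂ) := by exact_mod_cast (by positivity)
      simpa using h0
    · have h1 := h hy
      have h2 : (0 : ℂ) ≤ ((s * ‖x 0 + (s : ℂ)⁻¹ * (v ⬝ᵥ fun i => x i.succ)‖ ^ 2 : ℝ) : ℂ) := by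
        exact_mod_cast (by positivity)
      exact add_pos_of_nonneg_of_pos h2 h1

end Bordered

/-! ### Splitting off the first row of a Hermitian matrix. -/

section HermitianCoordinates

variable {k : ℕ}

/-- The upper triangular index pairs of a `(k+1) × (k+1)` matrix. -/
def upperPairsSuccEquiv (k : ℕ) : Fin k ⊕ {p : Fin k × Fin k // p.1 < p.2} ≃
    {p : Fin (k + 1) × Fin (k + 1) // p.1 < p.2} where
  toFun := Sum.elim (fun j => ⟨(0, j.succ), Fin.succ_pos j⟩)
    fun p => ⟨(p.1.1.succ, p.1.2.succ), Fin.succ_lt_succ_iff.2 p.2⟩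
  invFun p := if h : p.1.1 = 0 then
      Sum.inl (p.1.2.pred (fun h2 => by have := p.2; rw [h2] at this; exact absurd this (Fin.not_lt_zero _)))
    else Sum.inr ⟨(p.1.1.pred h, p.1.2.pred (fun h2 => by
      have := p.2; rw [h2] at this; exact absurd this (Fin.not_lt_zero _))), by
        simpa using p.2⟩
  left_inv x := by
    rcases x with j | p <;> simp
  right_inv p := by
    rcases p with ⟨⟨i, j⟩, h⟩
    by_cases hi : i = 0
    · subst hi; simp
    · simp [hi]

/-- Assemble the entries of a bordered Hermitian matrix. -/
def hermitianCons (s : ℝ) (v : Fin k → ℂ) (h : HermitianEntries k) : HermitianEntries (k + 1) :=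
  (Fin.cons s h.1, fun p => Sum.elim v h.2 ((upperPairsSuccEquiv k).symm p))

theorem hermitianOfEntries_hermitianCons (s : ℝ) (v : Fin k → ℂ) (h : HermitianEntries k) :
    hermitianOfEntries (hermitianCons s v h) = borderedMatrix s v (hermitianOfEntries h) := by
  ext i j
  refine Fin.cases ?_ (fun i => ?_) i <;> refine Fin.cases ?_ (fun j => ?_) j
  · simp [hermitianOfEntries, hermitianCons]
  · simp [hermitianOfEntries, hermitianCons, upperPairsSuccEquiv]
  · simp [hermitianOfEntries, hermitianCons, upperPairsSuccEquiv]
  · simp [hermitianOfEntries, hermitianCons, upperPairsSuccEquiv]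

theorem measurable_hermitianCons : Measurable fun x : (ℝ × (Fin k → ℂ)) × HermitianEntries k =>
    hermitianCons x.1.1 x.1.2 x.2 := by
  refine Measurable.prodMk ?_ ?_
  · exact (measurable_fin_cons k).comp (by fun_prop :
      Measurable fun x : (ℝ × (Fin k → ℂ)) × HermitianEntries k => (x.1.1, x.2.1))
  · rw [measurable_pi_iff]
    intro p
    rcases (upperPairsSuccEquiv k).symm p with j | q
    · simp only [Sum.elim_inl]; fun_prop
    · simp only [Sum.elim_inr]; fun_prop

theorem lintegral_hermitianEntries_succ (f : HermitianEntries (k + 1) → ℝ≥0∞) (hf : Measurable f) :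
    ∫⁻ h, f h = ∫⁻ s : ℝ, ∫⁻ v : Fin k → ℂ, ∫⁻ h : HermitianEntries k, f (hermitianCons s v h) := by
  rw [Measure.volume_eq_prod, lintegral_prod _ hf.aemeasurable]
  have hm : Measurable fun a : Fin (k + 1) → ℝ =>
      ∫⁻ b : {p : Fin (k + 1) × Fin (k + 1) // p.1 < p.2} → ℂ, f (a, b) :=
    Measurable.lintegral_prod_right' hf
  rw [volume_pi, lintegral_pi_fin_succ _ _ _ hm]
  refine lintegral_congr fun s => ?_
  have hmp : MeasurePreserving (fun x : (Fin k → ℂ) × ({p : Fin k × Fin k // p.1 < p.2} → ℂ) =>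
      fun p => Sum.elim x.1 x.2 ((upperPairsSuccEquiv k).symm p)) := by
    have h1 := (volume_measurePreserving_sumPiEquivProdPi
      (fun _ : Fin k ⊕ {p : Fin k × Fin k // p.1 < p.2} => ℂ)).symm
    have h2 := volume_measurePreserving_piCongrLeft
      (fun _ : {p : Fin (k + 1) × Fin (k + 1) // p.1 < p.2} => ℂ) (upperPairsSuccEquiv k)
    have e : (fun (x : (Fin k → ℂ) × ({p : Fin k × Fin k // p.1 < p.2} → ℂ)) p =>
        Sum.elim x.1 x.2 ((upperPairsSuccEquiv k).symm p)) =
        (MeasurableEquiv.piCongrLeft (fun _ => ℂ) (upperPairsSuccEquiv k)) ∘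
          (MeasurableEquiv.sumPiEquivProdPi fun _ => ℂ).symm := by
      funext x p
      obtain ⟨q, rfl⟩ := (upperPairsSuccEquiv k).surjective p
      rw [Equiv.symm_apply_apply, Function.comp_apply, MeasurableEquiv.coe_piCongrLeft,
        Equiv.piCongrLeft_apply_apply]
      cases q <;> rfl
    rw [e]
    exact h2.comp h1
  have h3 : ∀ a : Fin k → ℝ, ∫⁻ b : {p : Fin (k + 1) × Fin (k + 1) // p.1 < p.2} → ℂ,
      f (Fin.cons s a, b) = ∫⁻ v : Fin k → ℂ, ∫⁻ b : {p : Fin k × Fin k // p.1 < p.2} → ℂ,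
        f (hermitianCons s v (a, b)) := by
    intro a
    have hfa : Measurable fun b : {p : Fin (k + 1) × Fin (k + 1) // p.1 < p.2} → ℂ =>
      f (Fin.cons s a, b) := hf.comp measurable_prodMk_left
    rw [← hmp.lintegral_comp hfa, Measure.volume_eq_prod, lintegral_prod]
    · rfl
    · exact (hfa.comp hmp.measurable).aemeasurable
  have hF : Measurable fun x : ((Fin k → ℝ) × (Fin k → ℂ)) × ({p : Fin k × Fin k // p.1 < p.2} → ℂ) =>
      f (hermitianCons s x.1.2 (x.1.1, x.2)) :=
    hf.comp (measurable_hermitianCons.comp (by fun_prop :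
      Measurable fun x : ((Fin k → ℝ) × (Fin k → ℂ)) × ({p : Fin k × Fin k // p.1 < p.2} → ℂ) =>
        ((s, x.1.2), ((x.1.1, x.2) : HermitianEntries k))))
  simp_rw [← volume_pi, h3]
  rw [lintegral_lintegral_swap hF.lintegral_prod_right'.aemeasurable]
  refine lintegral_congr fun v => ?_
  rw [Measure.volume_eq_prod, lintegral_prod]
  exact (hf.comp (measurable_hermitianCons.comp
    (measurable_prodMk_left (x := ((s, v) : ℝ × (Fin k → ℂ)))))).aemeasurable

end HermitianCoordinates

/-! ### The image of Lebesgue measure under `W ↦ W Wᴴ`. -/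

section Wishart

open Matrix
open scoped ComplexOrder

variable {k : ℕ}

theorem isClosed_setOf_posSemidef :
    IsClosed {A : Fin k → Fin k → ℂ | (Matrix.of A).PosSemidef} := by
  simp_rw [posSemidef_iff_dotProduct_mulVec, Set.ofPred_and, Set.ofPred_forall]
  refine IsClosed.inter ?_ (isClosed_iInter fun x => ?_)
  · exact isClosed_eq (f := fun A : Fin k → Fin k → ℂ => (Matrix.of A).conjTranspose)
      (g := fun A => Matrix.of A) (Continuous.matrix_conjTranspose continuous_id) continuous_id
  · refine isClosed_le continuous_const ?_
    exact Continuous.dotProduct continuous_const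
      (Continuous.matrix_mulVec (A := fun A : Fin k → Fin k → ℂ => Matrix.of A)
        continuous_id continuous_const)

theorem measurable_matrix_comp {X : Type*} [MeasurableSpace X] {Y : Type*} [MeasurableSpace Y]
    {φ : Matrix (Fin k) (Fin k) ℂ → Y}
    (hφ : Measurable fun A : Fin k → Fin k → ℂ => φ (Matrix.of A))
    {M : X → Matrix (Fin k) (Fin k) ℂ} (hM : ∀ i j, Measurable fun x => M x i j) :
    Measurable fun x => φ (M x) :=
  hφ.comp (measurable_pi_lambda (fun x i j => M x i j) fun i =>
    measurable_pi_lambda _ fun j => hM i j)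

theorem measurable_det_of :
    Measurable fun A : Fin k → Fin k → ℂ => (Matrix.of A).det := by
  have h : Continuous fun A : Fin k → Fin k → ℂ => (Matrix.of A).det :=
    Continuous.matrix_det (A := fun A : Fin k → Fin k → ℂ => Matrix.of A) continuous_id
  exact h.measurable

/-- The positive definite cone is the closed semidefinite cone intersected with the measurable set
of nonzero determinant. -/
theorem measurableSet_posDef {X : Type*} [MeasurableSpace X]
    {M : X → Matrix (Fin k) (Fin k) ℂ} (hM : ∀ i j, Measurable fun x => M x i j) :
    MeasurableSet {x | (M x).PosDef} := by
  have h : {x | (M x).PosDef} = {x | (M x).PosSemidef} ∩ {x | (M x).det ≠ 0} := by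
    ext x
    constructor
    · intro h
      exact ⟨h.posSemidef, h.det_pos.ne'⟩
    · rintro ⟨h1, h2⟩
      exact h1.posDef_iff_isUnit.2 ((Matrix.isUnit_iff_isUnit_det _).2 (isUnit_iff_ne_zero.2 h2))
  rw [h]
  refine MeasurableSet.inter ?_ ?_
  · exact (measurable_pi_lambda (fun x i j => M x i j) fun i =>
      measurable_pi_lambda _ fun j => hM i j) isClosed_setOf_posSemidef.measurableSet
  · exact measurable_matrix_comp (φ := Matrix.det) measurable_det_of hM
      (measurableSet_singleton (0 : ℂ)).compl

theorem measurable_hermitianOfEntries (i j : Fin k) :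
    Measurable fun h : HermitianEntries k => hermitianOfEntries h i j := by
  unfold hermitianOfEntries
  simp only [Matrix.of_apply]
  split_ifs with h1 h2
  · fun_prop
  · exact Complex.continuous_conj.measurable.comp (by fun_prop)
  · fun_prop

instance instIsAddHaarMeasureVolumeHermitianEntries (k : ℕ) :
    (volume : Measure (HermitianEntries k)).IsAddHaarMeasure :=
  Measure.prod.instIsAddHaarMeasure _ _

/-- The functionally independent entries of a matrix. -/
def entriesOfMatrix (M : Matrix (Fin k) (Fin k) ℂ) : HermitianEntries k :=
  (fun i => (M i i).re, fun p => M p.1.1 p.1.2)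

theorem hermitianOfEntries_add (h h' : HermitianEntries k) :
    hermitianOfEntries (h + h') = hermitianOfEntries h + hermitianOfEntries h' := by
  ext i j
  simp only [hermitianOfEntries, Matrix.of_apply, Matrix.add_apply]
  split_ifs <;> simp

theorem hermitianOfEntries_smul (r : ℝ) (h : HermitianEntries k) :
    hermitianOfEntries (r • h) = (r : ℂ) • hermitianOfEntries h := by
  ext i j
  simp only [hermitianOfEntries, Matrix.of_apply, Matrix.smul_apply]
  split_ifs <;> simp

theorem hermitianOfEntries_neg (h : HermitianEntries k) :
    hermitianOfEntries (-h) = -hermitianOfEntries h := by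
  have := hermitianOfEntries_smul (-1) h
  simpa using this

theorem hermitianOfEntries_sub (h h' : HermitianEntries k) :
    hermitianOfEntries (h - h') = hermitianOfEntries h - hermitianOfEntries h' := by
  rw [sub_eq_add_neg, hermitianOfEntries_add, hermitianOfEntries_neg, sub_eq_add_neg]

theorem hermitianOfEntries_entriesOfMatrix {M : Matrix (Fin k) (Fin k) ℂ} (hM : M.IsHermitian) :
    hermitianOfEntries (entriesOfMatrix M) = M := by
  ext i j
  simp only [hermitianOfEntries, entriesOfMatrix, Matrix.of_apply]
  split_ifs with h1 h2
  · rfl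
  · exact hM.apply i j
  · obtain rfl : i = j := le_antisymm (not_lt.1 h2) (not_lt.1 h1)
    exact Complex.conj_eq_iff_re.1 (hM.apply i i)

/-- The constant relating Lebesgue measure on square matrices and on positive definite
Hermitian matrices. -/
def wishartConst (k : ℕ) : ℝ := ∏ j ∈ Finset.range k, Real.pi ^ (j + 1) / j.factorial

theorem wishartConst_pos (k : ℕ) : 0 < wishartConst k :=
  Finset.prod_pos fun j _ => by positivity

/-- The matrix `W Wᴴ`, where `W` has first row `w` and other rows `R`. -/
def gramCons (w : Fin (k + 1) → ℂ) (R : Fin k → Fin (k + 1) → ℂ) :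
    Matrix (Fin (k + 1)) (Fin (k + 1)) ℂ :=
  Matrix.of (Fin.cons w R) * (Matrix.of (Fin.cons w R))ᴴ

theorem measurable_gram_cons (φ : Matrix (Fin (k + 1)) (Fin (k + 1)) ℂ → ℝ≥0∞)
    (hφ : Measurable fun A : Fin (k + 1) → Fin (k + 1) → ℂ => φ (Matrix.of A)) :
    Measurable fun x : (Fin (k + 1) → ℂ) × (Fin k → Fin (k + 1) → ℂ) =>
      φ (gramCons x.1 x.2) := by
  refine measurable_matrix_comp hφ fun i j => ?_
  simp only [gramCons, Matrix.mul_apply, conjTranspose_apply, Matrix.of_apply]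
  have hm : ∀ i l, Measurable fun x : (Fin (k + 1) → ℂ) × (Fin k → Fin (k + 1) → ℂ) =>
      (Fin.cons x.1 x.2 : Fin (k + 1) → Fin (k + 1) → ℂ) i l := fun i l =>
    (measurable_pi_apply l).comp ((measurable_pi_apply i).comp (measurable_fin_cons k))
  exact Finset.measurable_sum _ fun l _ => (hm i l).mul
    (Complex.continuous_conj.measurable.comp (hm j l))

theorem measurable_gram_cons_right (φ : Matrix (Fin (k + 1)) (Fin (k + 1)) ℂ → ℝ≥0∞)
    (hφ : Measurable fun A : Fin (k + 1) → Fin (k + 1) → ℂ => φ (Matrix.of A))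
    (w : Fin (k + 1) → ℂ) :
    Measurable fun R : Fin k → Fin (k + 1) → ℂ =>
      φ (gramCons w R) := by
  have h : Measurable (Prod.mk w : (Fin k → Fin (k + 1) → ℂ) → _) := measurable_prodMk_left
  have h2 := Measurable.comp (measurable_gram_cons φ hφ) h
  exact h2

/-- Multiplying all rows on the right by one unitary matrix fixes `W Wᴴ` and preserves Lebesgue
measure on the remaining rows, so only the length of the first row matters. -/
theorem lintegral_gram_cons (φ : Matrix (Fin (k + 1)) (Fin (k + 1)) ℂ → ℝ≥0∞)
    (hφ : Measurable fun A : Fin (k + 1) → Fin (k + 1) → ℂ => φ (Matrix.of A))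
    (w : Fin (k + 1) → ℂ) :
    ∫⁻ R : Fin k → Fin (k + 1) → ℂ,
        φ (gramCons w R) =
      ∫⁻ R : Fin k → Fin (k + 1) → ℂ,
        φ (gramCons (Pi.single 0 ((Real.sqrt (∑ i, ‖w i‖ ^ 2) : ℝ) : ℂ)) R) := by
  obtain ⟨U, hU, hw⟩ := exists_unitary_vecMul_eq w
  have hmp : MeasurePreserving (fun (R : Fin k → Fin (k + 1) → ℂ) i => R i ᵥ* U) :=
    volume_preserving_pi fun _ => measurePreserving_vecMul_unitary U hU
  rw [← hw]
  symm
  rw [← hmp.lintegral_comp]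
  · refine lintegral_congr fun R => ?_
    have e : (Matrix.of (Fin.cons (w ᵥ* U) fun i => R i ᵥ* U) :
        Matrix (Fin (k + 1)) (Fin (k + 1)) ℂ) = Matrix.of (Fin.cons w R) * U := by
      ext i j
      refine Fin.cases ?_ (fun i => ?_) i
      · rfl
      · rfl
    rw [gramCons, gramCons, e, conjTranspose_mul, Matrix.mul_assoc, ← Matrix.mul_assoc U, hU, Matrix.one_mul]
  · exact measurable_gram_cons_right φ hφ _

/-- Once the first row is a multiple of a basis vector, the other rows split into a first column `u`
and a square block `R`; the Schur complement of the Gram matrix is `R Rᴴ`, which permits induction.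
-/
theorem gram_cons_single (s : ℝ) (hs : 0 < s) (u : Fin k → ℂ) (R : Fin k → Fin k → ℂ) :
    gramCons (Pi.single 0 ((Real.sqrt s : ℝ) : ℂ)) (fun i => Fin.cons (u i) (R i)) =
      borderedMatrix s (Real.sqrt s • star u)
        (vecMulVec u (star u) + Matrix.of R * (Matrix.of R)ᴴ) := by
  ext i j
  rw [gramCons, Matrix.mul_apply, Fin.sum_univ_succ]
  simp only [conjTranspose_apply, Matrix.of_apply]
  refine Fin.cases ?_ (fun i => ?_) i <;> refine Fin.cases ?_ (fun j => ?_) j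
  · simp [← Complex.ofReal_mul, Real.mul_self_sqrt hs.le]
  · simp
  · simp [mul_comm]
  · simp [vecMulVec_apply, Matrix.mul_apply]

theorem measurePreserving_cons_columns (k : ℕ) : MeasurePreserving
    (fun x : (Fin k → ℂ) × (Fin k → Fin k → ℂ) =>
      fun i => (Fin.cons (x.1 i) (x.2 i) : Fin (k + 1) → ℂ)) := by
  have h1 := (volume_measurePreserving_arrowProdEquivProdArrow ℂ (Fin k → ℂ) (Fin k)).symm
  have h2 : MeasurePreserving (fun (x : Fin k → ℂ × (Fin k → ℂ)) i =>
      (MeasurableEquiv.piFinSuccAbove (fun _ : Fin (k + 1) => ℂ) 0).symm (x i)) :=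
    volume_preserving_pi fun _ => (volume_preserving_piFinSuccAbove (fun _ : Fin (k + 1) => ℂ) 0).symm
  have e : (fun x : (Fin k → ℂ) × (Fin k → Fin k → ℂ) =>
      fun i => (Fin.cons (x.1 i) (x.2 i) : Fin (k + 1) → ℂ)) =
      (fun (x : Fin k → ℂ × (Fin k → ℂ)) i =>
      (MeasurableEquiv.piFinSuccAbove (fun _ : Fin (k + 1) => ℂ) 0).symm (x i)) ∘
      (MeasurableEquiv.arrowProdEquivProdArrow ℂ (Fin k → ℂ) (Fin k)).symm := by
    funext x i
    exact (Fin.insertNth_zero' (x.1 i) (x.2 i)).symm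
  rw [e]
  exact h2.comp h1

theorem lintegral_comp_smul_star (r : ℝ) (hr : 0 < r) (K : (Fin k → ℂ) → ℝ≥0∞) (hK : Measurable K) :
    ∫⁻ u : Fin k → ℂ, K (r • star u) = ENNReal.ofReal ((r ^ 2) ^ k)⁻¹ * ∫⁻ v, K v := by
  have h1 : MeasurePreserving (fun (u : Fin k → ℂ) i => conj (u i)) :=
    volume_preserving_pi fun _ => Complex.conjLIE.measurePreserving
  have h2 := Measure.map_addHaar_smul (volume : Measure (Fin k → ℂ)) hr.ne'
  have hm : Measurable fun u : Fin k → ℂ => r • u := measurable_const_smul r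
  have h3 : ∫⁻ u : Fin k → ℂ, K (r • star u) = ∫⁻ u : Fin k → ℂ, K (r • u) :=
    h1.lintegral_comp (hK.comp hm)
  rw [h3, ← lintegral_map hK hm, h2, lintegral_smul_measure, smul_eq_mul]
  congr 2
  have : Module.finrank ℝ (Fin k → ℂ) = 2 * k := by
    rw [Module.finrank_pi_fintype]; simp [mul_comm]
  rw [this, pow_mul, abs_of_pos (by positivity)]

/-- The measure on the first row of a positive definite matrix. -/
def posDefSlice (φ : Matrix (Fin (k + 1)) (Fin (k + 1)) ℂ → ℝ≥0∞) (s : ℝ) (v : Fin k → ℂ) : ℝ≥0∞ :=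
  ∫⁻ h : HermitianEntries k, {h | (borderedMatrix s v (hermitianOfEntries h)).PosDef}.indicator
    (fun h => φ (borderedMatrix s v (hermitianOfEntries h))) h

theorem measurable_borderedMatrix (i j : Fin (k + 1)) :
    Measurable fun x : (ℝ × (Fin k → ℂ)) × HermitianEntries k =>
      borderedMatrix x.1.1 x.1.2 (hermitianOfEntries x.2) i j := by
  refine Fin.cases ?_ (fun i => ?_) i <;> refine Fin.cases ?_ (fun j => ?_) j
  · simp only [borderedMatrix_zero_zero]; fun_prop
  · simp only [borderedMatrix_zero_succ]; fun_prop
  · simp only [borderedMatrix_succ_zero]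
    exact Complex.continuous_conj.measurable.comp (by fun_prop)
  · simp only [borderedMatrix_succ_succ]
    exact (measurable_hermitianOfEntries i j).comp measurable_snd

theorem measurable_posDefSlice (φ : Matrix (Fin (k + 1)) (Fin (k + 1)) ℂ → ℝ≥0∞)
    (hφ : Measurable fun A : Fin (k + 1) → Fin (k + 1) → ℂ => φ (Matrix.of A)) :
    Measurable fun x : ℝ × (Fin k → ℂ) => posDefSlice φ x.1 x.2 :=
  Measurable.lintegral_prod_right' (f := fun x : (ℝ × (Fin k → ℂ)) × HermitianEntries k =>
    {x : (ℝ × (Fin k → ℂ)) × HermitianEntries k |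
      (borderedMatrix x.1.1 x.1.2 (hermitianOfEntries x.2)).PosDef}.indicator
      (fun x => φ (borderedMatrix x.1.1 x.1.2 (hermitianOfEntries x.2))) x)
    ((measurable_matrix_comp hφ measurable_borderedMatrix).indicator
      (measurableSet_posDef measurable_borderedMatrix))

theorem inv_smul_vecMulVec_sqrt_smul (s : ℝ) (hs : 0 < s) (u : Fin k → ℂ) :
    ((s : ℂ)⁻¹ • vecMulVec (star (Real.sqrt s • star u)) (Real.sqrt s • star u)) =
      vecMulVec u (star u) := by
  have h1 : (s : ℂ) ≠ 0 := by exact_mod_cast hs.ne'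
  have h2 : ((Real.sqrt s : ℝ) : ℂ) * (Real.sqrt s : ℝ) = s := by
    rw [← Complex.ofReal_mul, Real.mul_self_sqrt hs.le]
  ext i j
  simp only [Matrix.smul_apply, vecMulVec_apply, Pi.star_apply, Pi.smul_apply, Complex.real_smul,
    smul_eq_mul, star_mul', RCLike.star_def, Complex.conj_ofReal]
  rw [mul_mul_mul_comm, h2, inv_mul_cancel_left₀ h1]
  simp

theorem isHermitian_vecMulVec_star (u : Fin k → ℂ) : (vecMulVec u (star u)).IsHermitian := by
  ext i j
  simp [vecMulVec_apply, mul_comm]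

theorem measurable_comp_borderedMatrix_add (φ : Matrix (Fin (k + 1)) (Fin (k + 1)) ℂ → ℝ≥0∞)
    (hφ : Measurable fun A : Fin (k + 1) → Fin (k + 1) → ℂ => φ (Matrix.of A))
    (s : ℝ) (v : Fin k → ℂ) (M : Matrix (Fin k) (Fin k) ℂ) :
    Measurable fun A : Fin k → Fin k → ℂ => φ (borderedMatrix s v (M + Matrix.of A)) := by
  refine measurable_matrix_comp hφ fun i j => ?_
  refine Fin.cases ?_ (fun i => ?_) i <;> refine Fin.cases ?_ (fun j => ?_) j
  · simp
  · simp
  · simp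
  · simp only [borderedMatrix_succ_succ, Matrix.add_apply, Matrix.of_apply]; fun_prop

/-- Translation by the rank one matrix `u uᴴ` turns positivity of the Schur complement into
positivity of the bordered matrix. -/
theorem lintegral_posDef_translate (φ : Matrix (Fin (k + 1)) (Fin (k + 1)) ℂ → ℝ≥0∞)
    (s : ℝ) (hs : 0 < s) (u : Fin k → ℂ) :
    ∫⁻ h : HermitianEntries k, {h | (hermitianOfEntries h).PosDef}.indicator
      (fun h => φ (borderedMatrix s (Real.sqrt s • star u)
        (vecMulVec u (star u) + hermitianOfEntries h))) h =
      posDefSlice φ s (Real.sqrt s • star u) := by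
  rw [posDefSlice, ← lintegral_sub_right_eq_self _ (entriesOfMatrix (vecMulVec u (star u)))]
  refine lintegral_congr fun h => ?_
  classical
  simp only [Set.indicator_apply, Set.mem_ofPred_eq, hermitianOfEntries_sub,
    hermitianOfEntries_entriesOfMatrix (isHermitian_vecMulVec_star u), add_sub_cancel,
    posDef_borderedMatrix_iff, inv_smul_vecMulVec_sqrt_smul s hs, hs, true_and]

/-- The factor `s⁻ᵏ` is the Jacobian of `u ↦ √s • star u` in real dimension `2k`. -/
theorem lintegral_gram_cons_single (c : ℝ≥0∞) (hc : c ≠ ∞)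
    (ih : ∀ φ : Matrix (Fin k) (Fin k) ℂ → ℝ≥0∞,
      (Measurable fun A : Fin k → Fin k → ℂ => φ (Matrix.of A)) →
      ∫⁻ W : Fin k → Fin k → ℂ, φ (Matrix.of W * (Matrix.of W)ᴴ) =
        c * ∫⁻ h : HermitianEntries k, {h | (hermitianOfEntries h).PosDef}.indicator
          (fun h => φ (hermitianOfEntries h)) h)
    (φ : Matrix (Fin (k + 1)) (Fin (k + 1)) ℂ → ℝ≥0∞)
    (hφ : Measurable fun A : Fin (k + 1) → Fin (k + 1) → ℂ => φ (Matrix.of A))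
    (s : ℝ) (hs : 0 < s) :
    ∫⁻ R : Fin k → Fin (k + 1) → ℂ,
        φ (gramCons (Pi.single 0 ((Real.sqrt s : ℝ) : ℂ)) R) =
      c * (ENNReal.ofReal (s ^ k)⁻¹ * ∫⁻ v, posDefSlice φ s v) := by
  have hmeas := measurable_gram_cons_right φ hφ (Pi.single 0 ((Real.sqrt s : ℝ) : ℂ))
  have hK : Measurable fun v : Fin k → ℂ => posDefSlice φ s v := by
    have h : Measurable (Prod.mk s : (Fin k → ℂ) → _) := measurable_prodMk_left
    have h2 := Measurable.comp (measurable_posDefSlice φ hφ) h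
    exact h2
  have hmc : Measurable fun a : (Fin k → ℂ) × (Fin k → Fin k → ℂ) =>
      φ (gramCons (Pi.single 0 ((Real.sqrt s : ℝ) : ℂ)) fun i => Fin.cons (a.1 i) (a.2 i)) := by
    have h := Measurable.comp hmeas (measurePreserving_cons_columns k).measurable
    exact h
  have hs2 := lintegral_comp_smul_star (Real.sqrt s) (Real.sqrt_pos.2 hs) _ hK
  rw [Real.sq_sqrt hs.le] at hs2
  rw [← hs2, ← lintegral_const_mul' _ _ hc, ← (measurePreserving_cons_columns k).lintegral_comp hmeas,
    Measure.volume_eq_prod, lintegral_prod _ hmc.aemeasurable]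
  refine lintegral_congr fun u => ?_
  simp only [gram_cons_single s hs]
  rw [← lintegral_posDef_translate φ s hs u]
  exact ih (fun S => φ (borderedMatrix s (Real.sqrt s • star u) (vecMulVec u (star u) + S)))
    (measurable_comp_borderedMatrix_add φ hφ _ _ _)

/-- The image of Lebesgue measure under `W ↦ W Wᴴ` is, up to a constant, Lebesgue measure on the
cone of positive definite Hermitian matrices. -/
theorem lintegral_mul_conjTranspose (k : ℕ) (φ : Matrix (Fin k) (Fin k) ℂ → ℝ≥0∞)
    (hφ : Measurable fun A : Fin k → Fin k → ℂ => φ (Matrix.of A)) :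
    ∫⁻ W : Fin k → Fin k → ℂ, φ (Matrix.of W * (Matrix.of W)ᴴ) =
      ENNReal.ofReal (wishartConst k) *
        ∫⁻ h : HermitianEntries k, {h | (hermitianOfEntries h).PosDef}.indicator
          (fun h => φ (hermitianOfEntries h)) h := by
  induction k with
  | zero =>
    have h0 : ∀ h : HermitianEntries 0, (hermitianOfEntries h).PosDef := fun h =>
      posDef_iff_dotProduct_mulVec.2 ⟨isHermitian_hermitianOfEntries _,
        fun {x} hx => absurd (Subsingleton.elim x 0) hx⟩
    have h1 : ∀ A : Matrix (Fin 0) (Fin 0) ℂ, φ A = φ 0 := fun A => by rw [Subsingleton.elim A 0]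
    have hv1 : (volume : Measure (Fin 0 → Fin 0 → ℂ)) Set.univ = 1 := by
      rw [volume_pi, Measure.pi_univ]; simp
    have hv2 : (volume : Measure (HermitianEntries 0)) Set.univ = 1 := by
      rw [Measure.volume_eq_prod, ← Set.univ_prod_univ, Measure.prod_prod, volume_pi, volume_pi,
        Measure.pi_univ, Measure.pi_univ]
      simp
    simp [h0, h1, hv1, hv2, wishartConst, Set.indicator]
  | succ k ih =>
    have hG : Measurable fun s : ℝ => ∫⁻ R : Fin k → Fin (k + 1) → ℂ,
        φ (gramCons (Pi.single 0 ((Real.sqrt s : ℝ) : ℂ)) R) := by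
      have h1 : Measurable fun w : Fin (k + 1) → ℂ => ∫⁻ R : Fin k → Fin (k + 1) → ℂ,
          φ (gramCons w R) :=
        (measurable_gram_cons φ hφ).lintegral_prod_right'
      have h2 : Measurable fun s : ℝ =>
          (Pi.single 0 ((Real.sqrt s : ℝ) : ℂ) : Fin (k + 1) → ℂ) := by
        refine measurable_pi_lambda _ fun i => ?_
        refine Fin.cases ?_ (fun i => ?_) i
        · simp only [Pi.single_eq_same]; fun_prop
        · simp
      exact h1.comp h2
    have hW : Measurable fun W : Fin (k + 1) → Fin (k + 1) → ℂ =>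
        φ (Matrix.of W * (Matrix.of W)ᴴ) := by
      refine measurable_matrix_comp hφ fun i j => ?_
      simp only [Matrix.mul_apply, conjTranspose_apply, Matrix.of_apply]
      exact Finset.measurable_sum _ fun l _ => Measurable.mul (by fun_prop)
        (Complex.continuous_conj.measurable.comp (by fun_prop))
    have hH : Measurable ({h : HermitianEntries (k + 1) | (hermitianOfEntries h).PosDef}.indicator
        fun h => φ (hermitianOfEntries h)) :=
      (measurable_matrix_comp hφ measurable_hermitianOfEntries).indicator
        (measurableSet_posDef measurable_hermitianOfEntries)
    have hR : ∀ s : ℝ, (∫⁻ v : Fin k → ℂ, ∫⁻ h : HermitianEntries k,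
        {h : HermitianEntries (k + 1) | (hermitianOfEntries h).PosDef}.indicator
        (fun h => φ (hermitianOfEntries h)) (hermitianCons s v h)) =
        (Set.Ioi (0 : ℝ)).indicator (fun s => ∫⁻ v : Fin k → ℂ, posDefSlice φ s v) s := by
      intro s
      have e : ∀ (v : Fin k → ℂ) (h : HermitianEntries k),
        {h : HermitianEntries (k + 1) | (hermitianOfEntries h).PosDef}.indicator
          (fun h => φ (hermitianOfEntries h)) (hermitianCons s v h) =
        {h | (borderedMatrix s v (hermitianOfEntries h)).PosDef}.indicator
          (fun h => φ (borderedMatrix s v (hermitianOfEntries h))) h := by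
        intro v h
        classical
        simp only [Set.indicator_apply, Set.mem_ofPred_eq, hermitianOfEntries_hermitianCons]
      simp_rw [e]
      by_cases hs : 0 < s
      · rw [Set.indicator_of_mem (Set.mem_Ioi.2 hs)]; rfl
      · rw [Set.indicator_of_notMem (by simpa using hs)]
        simp [posDef_borderedMatrix_iff, hs]
    rw [lintegral_hermitianEntries_succ _ hH]
    simp_rw [hR]
    rw [lintegral_indicator measurableSet_Ioi, volume_pi, lintegral_pi_fin_succ _ _ _ hW,
      ← volume_pi]
    have hL : ∀ w : Fin (k + 1) → ℂ, ∫⁻ R : Fin k → Fin (k + 1) → ℂ,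
        φ (Matrix.of (Fin.cons w R) * (Matrix.of (Fin.cons w R))ᴴ) = _ :=
      fun w => lintegral_gram_cons φ hφ w
    rw [lintegral_congr hL]
    rw [lintegral_comp_sum_norm_sq k _ hG, wishartConst, Finset.prod_range_succ, mul_comm (∏ _ ∈ _, _),
      ENNReal.ofReal_mul (by positivity), mul_assoc,
      ← lintegral_const_mul' (ENNReal.ofReal (∏ _ ∈ _, _)) _ ENNReal.ofReal_ne_top]
    congr 1
    refine setLIntegral_congr_fun measurableSet_Ioi fun s hs => ?_
    have hs' : 0 < s := hs
    -- The radial weight `s ^ k` from `ℂ^(k+1)` cancels the Jacobian `s⁻ᵏ`; hence the image measure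
    -- has constant density.
    rw [lintegral_gram_cons_single _ ENNReal.ofReal_ne_top (fun φ hφ => ih φ hφ) φ hφ s hs',
      mul_left_comm, ← mul_assoc (ENNReal.ofReal (s ^ k)), ← ENNReal.ofReal_mul (by positivity),
      mul_inv_cancel₀ (by positivity), ENNReal.ofReal_one, one_mul, wishartConst]

end Wishart

/-! ### The scalar weight `(1 + u/√N)^N exp (-√N u)`. -/

section OneVariable

/-- For `v ≥ 0` this is `log w ≤ sinh (log w) = (w - 1/w) / 2` at `w = 1 + v`. For `v ≤ 0` the
series of `-log (1 + v)` has nonnegative terms and is cut after two. -/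
theorem log_one_add_le {v : ℝ} (hv : -1 < v) :
    Real.log (1 + v) ≤ v - v ^ 2 / (2 * (1 + |v|)) := by
  rcases le_total 0 v with h | h
  · have hw : (0 : ℝ) < 1 + v := by linarith
    have h1 := Real.self_le_sinh_iff.2 (Real.log_nonneg (by linarith : (1 : ℝ) ≤ 1 + v))
    rw [Real.sinh_eq, Real.exp_log hw, Real.exp_neg, Real.exp_log hw] at h1
    rw [abs_of_nonneg h]
    refine h1.trans (le_of_eq ?_)
    field_simp
    ring
  · have h1 : -v + v ^ 2 / 2 ≤ -Real.log (1 + v) := by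
      have hs := Real.hasSum_pow_div_log_of_abs_lt_one (x := -v)
        (by rw [abs_neg, abs_of_nonpos h]; linarith)
      have := sum_le_hasSum (Finset.range 2) (fun i _ => by
        have : 0 ≤ -v := by linarith
        positivity) hs
      simp only [Finset.sum_range_succ, Finset.sum_range_zero] at this
      norm_num at this
      linarith
    have h2 : v ^ 2 / (2 * (1 + |v|)) ≤ v ^ 2 / 2 := by
      gcongr
      have := abs_nonneg v
      linarith
    linarith

/-- The scalar function whose product over the eigenvalues is the rescaled determinant. -/
def gaussApprox (N : ℕ) (u : ℝ) : ℝ :=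
  if 0 < 1 + u / Real.sqrt N then (1 + u / Real.sqrt N) ^ N * Real.exp (-(Real.sqrt N * u)) else 0

theorem gaussApprox_nonneg (N : ℕ) (u : ℝ) : 0 ≤ gaussApprox N u := by
  unfold gaussApprox
  split_ifs <;> positivity

theorem gaussApprox_eq_exp {N : ℕ} {u : ℝ} (hN : 0 < N) (h : 0 < 1 + u / Real.sqrt N) :
    gaussApprox N u =
      Real.exp (N * (Real.log (1 + u / Real.sqrt N) - u / Real.sqrt N)) := by
  have hs : Real.sqrt N * Real.sqrt N = N := Real.mul_self_sqrt N.cast_nonneg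
  have hp : 0 < Real.sqrt N := Real.sqrt_pos.2 (by exact_mod_cast hN)
  have e : (N : ℝ) * (u / Real.sqrt N) = Real.sqrt N * u := by
    nth_rewrite 1 [← hs]
    field_simp
  rw [gaussApprox, if_pos h, mul_sub, e, sub_eq_add_neg, Real.exp_add, Real.exp_nat_mul,
    Real.exp_log h]

/-- With `v = u/√N` and `|v| ≤ |u|`, the exponent is at most `-u² / (2 (1 + |u|))`, which is at most
`(1 - |u|) / 2`. The bound is independent of `N` and serves as the dominating function. -/
theorem gaussApprox_le {N : ℕ} (hN : 0 < N) (u : ℝ) :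
    gaussApprox N u ≤ Real.exp (1 / 2 - |u| / 2) := by
  by_cases h : 0 < 1 + u / Real.sqrt N
  · rw [gaussApprox_eq_exp hN h, Real.exp_le_exp]
    have h1N : (1 : ℝ) ≤ N := by exact_mod_cast hN
    have hs : Real.sqrt N * Real.sqrt N = N := Real.mul_self_sqrt N.cast_nonneg
    have h1s : 1 ≤ Real.sqrt N := Real.one_le_sqrt.2 h1N
    have hp : 0 < Real.sqrt N := by linarith
    have h1 := log_one_add_le (v := u / Real.sqrt N) (by linarith)
    have hau : |u / Real.sqrt N| ≤ |u| := by
      rw [abs_div, abs_of_pos hp]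
      exact div_le_self (abs_nonneg u) h1s
    have h2 : (u / Real.sqrt N) ^ 2 / (2 * (1 + |u|)) ≤
        (u / Real.sqrt N) ^ 2 / (2 * (1 + |u / Real.sqrt N|)) := by gcongr
    have h3 : (N : ℝ) * ((u / Real.sqrt N) ^ 2 / (2 * (1 + |u|))) = u ^ 2 / (2 * (1 + |u|)) := by
      rw [div_pow, Real.sq_sqrt N.cast_nonneg]
      field_simp
    have h4 : |u| / 2 - 1 / 2 ≤ u ^ 2 / (2 * (1 + |u|)) := by
      rw [le_div_iff₀ (by positivity), ← sq_abs]
      nlinarith [abs_nonneg u]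
    calc (N : ℝ) * (Real.log (1 + u / Real.sqrt N) - u / Real.sqrt N)
        ≤ N * (-((u / Real.sqrt N) ^ 2 / (2 * (1 + |u|)))) := by
          gcongr
          linarith
      _ = -(u ^ 2 / (2 * (1 + |u|))) := by rw [mul_neg, h3]
      _ ≤ _ := by linarith
  · rw [gaussApprox, if_neg h]
    positivity

theorem tendsto_gaussApprox (u : ℝ) :
    Tendsto (fun N : ℕ => gaussApprox N u) atTop (nhds (Real.exp (-u ^ 2 / 2))) := by
  have hsq : Tendsto (fun N : ℕ => Real.sqrt N) atTop atTop :=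
    Real.tendsto_sqrt_atTop.comp tendsto_natCast_atTop_atTop
  have h0 : Tendsto (fun N : ℕ => 2 * |u| ^ 3 / Real.sqrt N) atTop (nhds 0) :=
    hsq.const_div_atTop _
  have hlim : Tendsto (fun N : ℕ => (N : ℝ) * (Real.log (1 + u / Real.sqrt N) - u / Real.sqrt N))
      atTop (nhds (-u ^ 2 / 2)) := by
    rw [tendsto_iff_norm_sub_tendsto_zero]
    refine squeeze_zero' (Eventually.of_forall fun _ => norm_nonneg _) ?_ h0
    filter_upwards [hsq.eventually_ge_atTop (2 * |u| + 1)] with N hN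
    have hp : 0 < Real.sqrt N := by linarith [abs_nonneg u]
    have hs : Real.sqrt N ^ 2 = N := Real.sq_sqrt N.cast_nonneg
    have hb := abs_log_one_add_sub_le (x := u / Real.sqrt N) (by
      rw [abs_div, abs_of_pos hp, div_le_iff₀ hp]; linarith)
    have e : (N : ℝ) * (Real.log (1 + u / Real.sqrt N) - u / Real.sqrt N) - -u ^ 2 / 2 =
        N * (Real.log (1 + u / Real.sqrt N) - u / Real.sqrt N + (u / Real.sqrt N) ^ 2 / 2) := by
      rw [mul_add, div_pow, hs]
      have : (N : ℝ) ≠ 0 := by rw [← hs]; positivity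
      field_simp
      ring
    rw [e, Real.norm_eq_abs, abs_mul, Nat.abs_cast]
    refine (mul_le_mul_of_nonneg_left hb N.cast_nonneg).trans (le_of_eq ?_)
    rw [abs_div, abs_of_pos hp]
    nth_rewrite 1 [← hs]
    field_simp
  refine ((Real.continuous_exp.tendsto _).comp hlim).congr' ?_
  filter_upwards [hsq.eventually_ge_atTop (2 * |u| + 1), eventually_gt_atTop 0] with N hN hN0
  have hp : 0 < Real.sqrt N := by linarith [abs_nonneg u]
  have hpos : 0 < 1 + u / Real.sqrt N := by
    have : -1 < u / Real.sqrt N := by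
      rw [lt_div_iff₀ hp]
      linarith [neg_abs_le u, abs_nonneg u]
    linarith
  rw [Function.comp_apply, gaussApprox_eq_exp hN0 hpos]

end OneVariable

/-! ### Determinant, traces and positivity through eigenvalues. -/

section Spectral

open Matrix
open scoped ComplexOrder

variable {k : ℕ} {H : Matrix (Fin k) (Fin k) ℂ} (hH : H.IsHermitian)

theorem smul_one_add_smul_eq_conj (a b : ℝ) : (a : ℂ) • (1 : Matrix (Fin k) (Fin k) ℂ) + (b : ℂ) • H =
    (hH.eigenvectorUnitary : Matrix (Fin k) (Fin k) ℂ) *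
      diagonal (fun i => ((a + b * hH.eigenvalues i : ℝ) : ℂ)) *
      star (hH.eigenvectorUnitary : Matrix (Fin k) (Fin k) ℂ) := by
  have h := hH.spectral_theorem
  have e : diagonal (fun i => ((a + b * hH.eigenvalues i : ℝ) : ℂ)) =
      (a : ℂ) • (1 : Matrix (Fin k) (Fin k) ℂ) +
        (b : ℂ) • diagonal (RCLike.ofReal ∘ hH.eigenvalues) := by
    ext i j
    by_cases hij : i = j
    · subst hij; simp
    · simp [hij]
  have h2 : Unitary.conjStarAlgAut ℂ _ hH.eigenvectorUnitary
      (diagonal (fun i => ((a + b * hH.eigenvalues i : ℝ) : ℂ))) = _ :=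
    Unitary.conjStarAlgAut_apply _ _
  rw [← h2, e, map_add, map_smul, map_smul, map_one, ← h]

theorem posDef_smul_one_add_smul_iff (a b : ℝ) :
    ((a : ℂ) • (1 : Matrix (Fin k) (Fin k) ℂ) + (b : ℂ) • H).PosDef ↔
      ∀ i, 0 < a + b * hH.eigenvalues i := by
  have hU : IsUnit (hH.eigenvectorUnitary : Matrix (Fin k) (Fin k) ℂ) :=
    Unitary.isUnit_coe
  rw [smul_one_add_smul_eq_conj hH, hU.posDef_star_right_conjugate_iff, posDef_diagonal_iff]
  simp only [Complex.zero_lt_real]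

theorem det_smul_one_add_smul (a b : ℝ) :
    ((a : ℂ) • (1 : Matrix (Fin k) (Fin k) ℂ) + (b : ℂ) • H).det =
      ((∏ i, (a + b * hH.eigenvalues i) : ℝ) : ℂ) := by
  rw [smul_one_add_smul_eq_conj hH, det_mul_right_comm,
    Unitary.mul_star_self_of_mem hH.eigenvectorUnitary.2, one_mul,
    det_diagonal]
  push_cast
  rfl

theorem trace_re_eq_sum_eigenvalues : H.trace.re = ∑ i, hH.eigenvalues i := by
  rw [hH.trace_eq_sum_eigenvalues]
  simp

theorem trace_mul_self_re_eq_sum : (H * H).trace.re = ∑ i, hH.eigenvalues i ^ 2 := by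
  have h := smul_one_add_smul_eq_conj hH 0 1
  simp only [Complex.ofReal_zero, zero_smul, zero_add, Complex.ofReal_one, one_smul, one_mul] at h
  set U := (hH.eigenvectorUnitary : Matrix (Fin k) (Fin k) ℂ)
  have hU : star U * U = 1 := Unitary.coe_star_mul_self _
  have e : H * H = U * (diagonal (fun i => (hH.eigenvalues i : ℂ)) *
      diagonal (fun i => (hH.eigenvalues i : ℂ))) * star U := by
    nth_rewrite 1 2 [h]
    simp only [Matrix.mul_assoc]
    rw [← Matrix.mul_assoc (star U), hU, Matrix.one_mul]
  rw [e, trace_mul_comm, ← Matrix.mul_assoc, hU, Matrix.one_mul, diagonal_mul_diagonal, trace_diagonal]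
  simp [sq]

theorem sum_norm_sq_eq_trace (hH : H.IsHermitian) :
    ∑ i, ∑ j, ‖H i j‖ ^ 2 = (H * H).trace.re := by
  simp only [trace, diag_apply, Matrix.mul_apply, Complex.re_sum]
  refine Finset.sum_congr rfl fun i _ => Finset.sum_congr rfl fun j _ => ?_
  rw [← hH.apply j i, RCLike.star_def, Complex.mul_conj, Complex.ofReal_re, Complex.normSq_eq_norm_sq]

/-- Each entry is bounded by the Hilbert–Schmidt norm, which is the `ℓ²` norm of the eigenvalues,
and this is at most their `ℓ¹` norm. -/
theorem norm_le_sum_abs_eigenvalues (h : HermitianEntries k) :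
    ‖h‖ ≤ ∑ i, |(isHermitian_hermitianOfEntries h).eigenvalues i| := by
  set hH := isHermitian_hermitianOfEntries h
  have h0 : 0 ≤ ∑ i, |hH.eigenvalues i| := Finset.sum_nonneg fun _ _ => abs_nonneg _
  have key : ∀ i j, ‖hermitianOfEntries h i j‖ ≤ ∑ i, |hH.eigenvalues i| := by
    intro i j
    refine abs_le_of_sq_le_sq' ?_ h0 |>.2
    calc ‖hermitianOfEntries h i j‖ ^ 2 ≤ ∑ j, ‖hermitianOfEntries h i j‖ ^ 2 :=
          Finset.single_le_sum (f := fun j => ‖hermitianOfEntries h i j‖ ^ 2)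
            (fun _ _ => by positivity) (Finset.mem_univ j)
      _ ≤ ∑ i, ∑ j, ‖hermitianOfEntries h i j‖ ^ 2 :=
          Finset.single_le_sum (f := fun i => ∑ j, ‖hermitianOfEntries h i j‖ ^ 2)
            (fun _ _ => by positivity) (Finset.mem_univ i)
      _ = ∑ i, |hH.eigenvalues i| ^ 2 := by
          rw [sum_norm_sq_eq_trace hH, trace_mul_self_re_eq_sum hH]
          simp
      _ ≤ (∑ i, |hH.eigenvalues i|) ^ 2 := Finset.sum_sq_le_sq_sum_of_nonneg fun _ _ => abs_nonneg _
  rw [Prod.norm_def, max_le_iff, pi_norm_le_iff_of_nonneg h0, pi_norm_le_iff_of_nonneg h0]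
  constructor
  · intro i
    simpa [hermitianOfEntries] using key i i
  · intro p
    simpa [hermitianOfEntries, p.2] using key p.1.1 p.1.2

end Spectral

/-! ### The GUE: density, limit of the weights, distribution function, normalization. -/

section Gue

open Matrix
open scoped ComplexOrder

variable {k : ℕ}

/-- The Hermitian matrices whose eigenvalues are all larger than `-x`. -/
def shiftedCone (k : ℕ) (x : ℝ) : Set (HermitianEntries k) :=
  {h | ((x : ℂ) • (1 : Matrix (Fin k) (Fin k) ℂ) + hermitianOfEntries h).PosDef}

theorem mem_shiftedCone_iff {x : ℝ} {h : HermitianEntries k} : h ∈ shiftedCone k x ↔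
    ∀ i, 0 < x + (isHermitian_hermitianOfEntries h).eigenvalues i := by
  have := posDef_smul_one_add_smul_iff (isHermitian_hermitianOfEntries h) x 1
  simpa only [Complex.ofReal_one, one_smul, one_mul] using! this

theorem measurableSet_shiftedCone (x : ℝ) : MeasurableSet (shiftedCone k x) :=
  measurableSet_posDef fun i j => by
    simp only [Matrix.add_apply]
    exact measurable_const.add (measurable_hermitianOfEntries i j)

/-- The unnormalized GUE density. -/
def gueDensity (h : HermitianEntries k) : ℝ :=
  Real.exp (-(Matrix.trace (hermitianOfEntries h * hermitianOfEntries h)).re / 2)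

theorem gueDensity_pos (h : HermitianEntries k) : 0 < gueDensity h := Real.exp_pos _

theorem gueDensity_eq_prod (h : HermitianEntries k) : gueDensity h =
    ∏ i, Real.exp (-(isHermitian_hermitianOfEntries h).eigenvalues i ^ 2 / 2) := by
  rw [gueDensity, trace_mul_self_re_eq_sum (isHermitian_hermitianOfEntries h), ← Real.exp_sum,
    ← Finset.sum_neg_distrib, Finset.sum_div]

theorem measurable_gueDensity : Measurable (gueDensity : HermitianEntries k → ℝ) := by
  have : Measurable fun h : HermitianEntries k =>
      ∑ i, ∑ j, ‖hermitianOfEntries h i j‖ ^ 2 :=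
    Finset.measurable_sum _ fun i _ => Finset.measurable_sum _ fun j _ =>
      (measurable_hermitianOfEntries i j).norm.pow_const 2
  simp only [sum_norm_sq_eq_trace (isHermitian_hermitianOfEntries _)] at this
  exact (this.neg.div_const 2).exp

/-- The product of the scalar approximations over the eigenvalues. -/
def gaussApproxDet (N : ℕ) (h : HermitianEntries k) : ℝ :=
  ∏ i, gaussApprox N ((isHermitian_hermitianOfEntries h).eigenvalues i)

theorem gaussApproxDet_nonneg (N : ℕ) (h : HermitianEntries k) : 0 ≤ gaussApproxDet N h :=
  Finset.prod_nonneg fun _ _ => gaussApprox_nonneg _ _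

/-- Expressing the weight by determinant, trace and positivity yields measurability without any
measurability of individual eigenvalues. -/
theorem gaussApproxDet_eq (N : ℕ) (h : HermitianEntries k) : gaussApproxDet N h =
    {h : HermitianEntries k | (((1 : ℝ) : ℂ) • (1 : Matrix (Fin k) (Fin k) ℂ) +
        (((Real.sqrt N)⁻¹ : ℝ) : ℂ) • hermitianOfEntries h).PosDef}.indicator
      (fun h => ‖(((1 : ℝ) : ℂ) • (1 : Matrix (Fin k) (Fin k) ℂ) +
        (((Real.sqrt N)⁻¹ : ℝ) : ℂ) • hermitianOfEntries h).det‖ ^ N *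
        Real.exp (-(Real.sqrt N * (hermitianOfEntries h).trace.re))) h := by
  classical
  have hH := isHermitian_hermitianOfEntries h
  have hd : ∀ u : ℝ, 1 + u / Real.sqrt N = 1 + (Real.sqrt N)⁻¹ * u := fun u => by
    rw [div_eq_inv_mul]
  rw [Set.indicator_apply]
  simp only [Set.mem_ofPred_eq, posDef_smul_one_add_smul_iff hH]
  split_ifs with hp
  · rw [det_smul_one_add_smul hH, trace_re_eq_sum_eigenvalues hH, Complex.norm_real,
      Real.norm_of_nonneg (Finset.prod_nonneg fun i _ => (hp i).le), Finset.mul_sum,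
      ← Finset.sum_neg_distrib, Real.exp_sum, ← Finset.prod_pow, ← Finset.prod_mul_distrib,
      gaussApproxDet]
    refine Finset.prod_congr rfl fun i _ => ?_
    rw [gaussApprox, hd, if_pos (hp i)]
  · push Not at hp
    obtain ⟨i, hi⟩ := hp
    refine Finset.prod_eq_zero (Finset.mem_univ i) ?_
    rw [gaussApprox, hd, if_neg (not_lt.2 hi)]

theorem measurable_gaussApproxDet (N : ℕ) :
    Measurable (gaussApproxDet N : HermitianEntries k → ℝ) := by
  have hM : ∀ i j, Measurable fun h : HermitianEntries k =>
      (((1 : ℝ) : ℂ) • (1 : Matrix (Fin k) (Fin k) ℂ) +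
        (((Real.sqrt N)⁻¹ : ℝ) : ℂ) • hermitianOfEntries h) i j := fun i j => by
    simp only [Matrix.add_apply, Matrix.smul_apply, smul_eq_mul]
    exact measurable_const.add ((measurable_hermitianOfEntries i j).const_mul _)
  have ht : Measurable fun h : HermitianEntries k => (hermitianOfEntries h).trace.re :=
    Complex.measurable_re.comp (Finset.measurable_sum _ fun i _ => measurable_hermitianOfEntries i i)
  rw [show (gaussApproxDet N : HermitianEntries k → ℝ) = _ from funext (gaussApproxDet_eq N)]
  refine Measurable.indicator ?_ (measurableSet_posDef hM)
  exact ((measurable_matrix_comp (φ := Matrix.det) measurable_det_of hM).norm.pow_const N).mul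
    (ht.const_mul _).neg.exp

theorem gaussApproxDet_le {N : ℕ} (hN : 0 < N) (h : HermitianEntries k) :
    gaussApproxDet N h ≤ Real.exp (k / 2 - ‖h‖ / 2) := by
  have h1 : gaussApproxDet N h ≤
      ∏ i, Real.exp (1 / 2 - |(isHermitian_hermitianOfEntries h).eigenvalues i| / 2) :=
    Finset.prod_le_prod (fun _ _ => gaussApprox_nonneg _ _) fun _ _ => gaussApprox_le hN _
  refine h1.trans ?_
  rw [← Real.exp_sum, Real.exp_le_exp, Finset.sum_sub_distrib, ← Finset.sum_div,
    ← Finset.sum_div]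
  have := norm_le_sum_abs_eigenvalues h
  simp only [Finset.sum_const, Finset.card_univ, Fintype.card_fin, nsmul_eq_mul]
  linarith

theorem tendsto_gaussApproxDet (h : HermitianEntries k) :
    Tendsto (fun N : ℕ => gaussApproxDet N h) atTop (nhds (gueDensity h)) := by
  rw [gueDensity_eq_prod]
  exact tendsto_finsetProd _ fun i _ => tendsto_gaussApprox _

theorem gueDensity_le (h : HermitianEntries k) : gueDensity h ≤ Real.exp (k / 2 - ‖h‖ / 2) :=
  le_of_tendsto (tendsto_gaussApproxDet h)
    ((eventually_gt_atTop 0).mono fun _ hN => gaussApproxDet_le hN h)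

/-- Comparison with `(1 + ‖x‖)⁻ᵐ`, integrable for `m` above the dimension, through `tᵐ / m! ≤ exp t`
at `t = (1 + ‖x‖) / 2`. -/
theorem integrable_exp_neg_half_norm {E : Type*} [NormedAddCommGroup E] [NormedSpace ℝ E]
    [FiniteDimensional ℝ E] [MeasurableSpace E] [BorelSpace E] (μ : Measure E) [μ.IsAddHaarMeasure]
    (a : ℝ) : Integrable (fun x : E => Real.exp (a - ‖x‖ / 2)) μ := by
  set m := Module.finrank ℝ E + 1 with hm
  have h := integrable_one_add_norm (μ := μ) (E := E) (r := (m : ℝ)) (by rw [hm]; push_cast; linarith)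
  refine (h.const_mul (Real.exp (a + 1 / 2) * (m.factorial * 2 ^ m))).mono'
    (Measurable.aestronglyMeasurable (by fun_prop)) (ae_of_all _ fun x => ?_)
  rw [Real.norm_of_nonneg (Real.exp_pos _).le, Real.rpow_neg (by positivity), Real.rpow_natCast]
  have h1 := Real.pow_div_factorial_le_exp (x := (1 + ‖x‖) / 2) (by positivity) m
  rw [div_pow, div_div, div_le_iff₀ (by positivity)] at h1
  rw [← div_eq_mul_inv, le_div_iff₀ (by positivity)]
  calc Real.exp (a - ‖x‖ / 2) * (1 + ‖x‖) ^ m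
      ≤ Real.exp (a - ‖x‖ / 2) * (Real.exp ((1 + ‖x‖) / 2) * (2 ^ m * m.factorial)) := by gcongr
    _ = Real.exp (a + 1 / 2) * (m.factorial * 2 ^ m) := by
      rw [← mul_assoc, ← Real.exp_add]
      ring_nf

theorem integrable_gaussApproxDet {N : ℕ} (hN : 0 < N) :
    Integrable (gaussApproxDet N : HermitianEntries k → ℝ) :=
  (integrable_exp_neg_half_norm volume (k / 2)).mono' (measurable_gaussApproxDet N).aestronglyMeasurable
    (ae_of_all _ fun h => by
      rw [Real.norm_of_nonneg (gaussApproxDet_nonneg _ _)]; exact gaussApproxDet_le hN h)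

theorem integrable_gueDensity : Integrable (gueDensity : HermitianEntries k → ℝ) :=
  (integrable_exp_neg_half_norm volume (k / 2)).mono' measurable_gueDensity.aestronglyMeasurable
    (ae_of_all _ fun h => by
      rw [Real.norm_of_nonneg (gueDensity_pos h).le]; exact gueDensity_le h)

/-- Convergence in `L¹` bounds the error on every cone simultaneously, which is the source of
uniformity in `z`. -/
theorem tendsto_integral_abs_gaussApproxDet_sub (k : ℕ) :
    Tendsto (fun N : ℕ => ∫ h : HermitianEntries k, |gaussApproxDet N h - gueDensity h|) atTop
      (nhds 0) := by
  have h := tendsto_integral_filter_of_dominated_convergence (μ := volume) (l := atTop)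
    (F := fun (N : ℕ) (h : HermitianEntries k) => |gaussApproxDet N h - gueDensity h|)
    (f := fun _ => 0) (fun h => Real.exp (k / 2 - ‖h‖ / 2))
    (Eventually.of_forall fun N =>
      ((measurable_gaussApproxDet N).sub measurable_gueDensity).abs.aestronglyMeasurable)
    ((eventually_gt_atTop 0).mono fun N hN => ae_of_all _ fun h => by
      rw [Real.norm_of_nonneg (abs_nonneg _), abs_le]
      have h1 := gaussApproxDet_le hN h
      have h2 := gueDensity_le h
      have h3 := gaussApproxDet_nonneg N h
      have h4 := gueDensity_pos h
      constructor <;> linarith)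
    (integrable_exp_neg_half_norm volume (k / 2))
    (ae_of_all _ fun h => by
      have := ((tendsto_gaussApproxDet h).sub_const (gueDensity h)).abs
      simpa using this)
  simpa using h

/-- A null positive definite cone would, by `lintegral_mul_conjTranspose` with `φ = 1`, make the
space of all square matrices null. A shifted cone is a translate. -/
theorem volume_shiftedCone_ne_zero (x : ℝ) : volume (shiftedCone k x) ≠ 0 := by
  have h0 : volume {h : HermitianEntries k | (hermitianOfEntries h).PosDef} ≠ 0 := by
    intro h
    have h1 := lintegral_mul_conjTranspose k (fun _ => 1) measurable_const
    rw [lintegral_indicator (measurableSet_posDef measurable_hermitianOfEntries), setLIntegral_one,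
      h, mul_zero, lintegral_one] at h1
    rw [volume_pi, Measure.pi_univ, Finset.prod_eq_zero_iff] at h1
    obtain ⟨_, _, h2⟩ := h1
    rw [volume_pi, Measure.pi_univ, Finset.prod_eq_zero_iff] at h2
    obtain ⟨_, _, h3⟩ := h2
    simp at h3
  have hone : (((x : ℝ) : ℂ) • (1 : Matrix (Fin k) (Fin k) ℂ)).IsHermitian := by
    ext i j
    by_cases hij : i = j
    · subst hij; simp
    · simp [hij, Ne.symm hij]
  have e : shiftedCone k x =
      (fun h => entriesOfMatrix (((x : ℝ) : ℂ) • (1 : Matrix (Fin k) (Fin k) ℂ)) + h) ⁻¹'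
        {h : HermitianEntries k | (hermitianOfEntries h).PosDef} := by
    ext h
    simp only [shiftedCone, Set.mem_preimage, Set.mem_ofPred_eq, hermitianOfEntries_add,
      hermitianOfEntries_entriesOfMatrix hone]
  rw [e, measure_preimage_add]
  exact h0

theorem setIntegral_gueDensity_pos (x : ℝ) : 0 < ∫ h in shiftedCone k x, gueDensity h := by
  rw [setIntegral_pos_iff_support_of_nonneg_ae (ae_of_all _ fun h => (gueDensity_pos h).le)
    integrable_gueDensity.integrableOn]
  have : Function.support (gueDensity : HermitianEntries k → ℝ) = Set.univ :=
    Set.eq_univ_of_forall fun h => (gueDensity_pos h).ne'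
  rw [this, Set.univ_inter]
  exact pos_iff_ne_zero.2 (volume_shiftedCone_ne_zero x)

theorem largestEigenvalue_lt_iff (h : HermitianEntries k) (x : ℝ) :
    largestEigenvalue h < (x : EReal) ↔ -h ∈ shiftedCone k x := by
  have h1 : -h ∈ shiftedCone k x ↔ ∀ i, (isHermitian_hermitianOfEntries h).eigenvalues i < x := by
    have := posDef_smul_one_add_smul_iff (isHermitian_hermitianOfEntries h) x (-1)
    rw [shiftedCone, Set.mem_ofPred_eq, hermitianOfEntries_neg]
    simp only [Complex.ofReal_neg, Complex.ofReal_one, neg_smul, one_smul, neg_mul, one_mul] at this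
    rw [this]
    refine forall_congr' fun i => ?_
    constructor <;> intro h <;> linarith
  rw [h1, largestEigenvalue]
  constructor
  · intro h2 i
    exact_mod_cast (le_iSup (fun i => ((isHermitian_hermitianOfEntries h).eigenvalues i : EReal)) i).trans_lt h2
  · intro h2
    rcases isEmpty_or_nonempty (Fin k) with he | he
    · rw [iSup_of_empty]; exact EReal.bot_lt_coe x
    · obtain ⟨i, hi⟩ := exists_eq_ciSup_of_finite
        (f := fun i => ((isHermitian_hermitianOfEntries h).eigenvalues i : EReal))
      rw [← hi]
      exact_mod_cast h2 i

theorem gueWeight_eq (k : ℕ) :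
    gueWeight k = volume.withDensity fun h => ENNReal.ofReal (gueDensity h) := rfl

theorem gueWeight_preimage_neg {s : Set (HermitianEntries k)} (hs : MeasurableSet s) :
    gueWeight k {h | -h ∈ s} = ENNReal.ofReal (∫ h in s, gueDensity h) := by
  have hs' : MeasurableSet {h : HermitianEntries k | -h ∈ s} := measurable_neg hs
  have hneg : MeasurePreserving (fun h : HermitianEntries k => -h) :=
    ⟨measurable_neg, by
      simpa [abs_pow] using!
        Measure.map_addHaar_smul (volume : Measure (HermitianEntries k)) (r := -1) (by norm_num)⟩
  rw [gueWeight_eq, withDensity_apply _ hs', ofReal_integral_eq_lintegral_ofReal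
    integrable_gueDensity.integrableOn (ae_of_all _ fun h => (gueDensity_pos h).le),
    ← lintegral_indicator hs', ← lintegral_indicator hs,
    ← hneg.lintegral_comp
      (measurable_gueDensity.ennreal_ofReal.indicator hs)]
  refine lintegral_congr fun h => ?_
  classical
  have e : gueDensity (-h) = gueDensity h := by
    rw [gueDensity, gueDensity, hermitianOfEntries_neg, neg_mul_neg]
  simp only [Set.indicator_apply, Set.mem_ofPred_eq, e]

/-- The distribution function of the largest eigenvalue as a ratio of integrals. -/
theorem gueMaxCDF_eq (k : ℕ) (x : ℝ) : gueMaxCDF k x =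
    (∫ h in shiftedCone k x, gueDensity h) / ∫ h : HermitianEntries k, gueDensity h := by
  have h1 : gueWeight k Set.univ = ENNReal.ofReal (∫ h : HermitianEntries k, gueDensity h) := by
    have := gueWeight_preimage_neg (k := k) MeasurableSet.univ
    simpa using this
  have h2 : {h : HermitianEntries k | largestEigenvalue h < (x : EReal)} =
      {h | -h ∈ shiftedCone k x} := by
    ext h; exact largestEigenvalue_lt_iff h x
  rw [gueMaxCDF, gueLaw, measureReal_def, Measure.smul_apply, h1, h2,
    gueWeight_preimage_neg (measurableSet_shiftedCone x), smul_eq_mul, ENNReal.toReal_mul,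
    ENNReal.toReal_inv, ENNReal.toReal_ofReal (integral_nonneg fun h => (gueDensity_pos h).le),
    ENNReal.toReal_ofReal (integral_nonneg fun h => (gueDensity_pos h).le), div_eq_inv_mul]

theorem lintegral_exp_neg_sum_norm_sq (k : ℕ) :
    ∫⁻ v : Fin k → ℂ, ENNReal.ofReal (Real.exp (-∑ i, ‖v i‖ ^ 2)) = ENNReal.ofReal (Real.pi ^ k) := by
  have hprob : IsProbabilityMeasure (volume.withDensity complexNormalPDF) := by
    rw [← stdComplexNormal_eq]; infer_instance
  have h := lintegral_pi_withDensity volume complexNormalPDF measurable_complexNormalPDF k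
    (fun _ => 1) measurable_const
  rw [lintegral_one, measure_univ] at h
  have e : ∀ v : Fin k → ℂ, (∏ i, complexNormalPDF (v i)) * 1 =
      ENNReal.ofReal (Real.pi ^ k)⁻¹ * ENNReal.ofReal (Real.exp (-∑ i, ‖v i‖ ^ 2)) := by
    intro v
    simp only [complexNormalPDF]
    rw [mul_one, ← ENNReal.ofReal_prod_of_nonneg (fun _ _ => by positivity),
      ← ENNReal.ofReal_mul (by positivity), Finset.prod_mul_distrib, ← Real.exp_sum,
      Finset.sum_neg_distrib]
    simp
  simp_rw [e] at h
  rw [lintegral_const_mul' _ _ ENNReal.ofReal_ne_top, ENNReal.ofReal_inv_of_pos (by positivity)] at h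
  rw [volume_pi]
  have hp : ENNReal.ofReal (Real.pi ^ k) ≠ 0 := by
    simp only [ne_eq, ENNReal.ofReal_eq_zero, not_le]; positivity
  have := congrArg (fun t => ENNReal.ofReal (Real.pi ^ k) * t) h
  simp only [mul_one] at this
  rw [← mul_assoc, ENNReal.mul_inv_cancel hp ENNReal.ofReal_ne_top, one_mul] at this
  exact this.symm

/-- The normalization constant of the GUE. -/
theorem integral_gueDensity (k : ℕ) : ∫ h : HermitianEntries k, gueDensity h =
    ∏ j ∈ Finset.range k, (Real.sqrt (2 * Real.pi) * Real.pi ^ j) := by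
  suffices h : ∫⁻ h : HermitianEntries k, ENNReal.ofReal (gueDensity h) =
      ENNReal.ofReal (∏ j ∈ Finset.range k, (Real.sqrt (2 * Real.pi) * Real.pi ^ j)) by
    rw [integral_eq_lintegral_of_nonneg_ae (ae_of_all _ fun h => (gueDensity_pos h).le)
      measurable_gueDensity.aestronglyMeasurable, h,
      ENNReal.toReal_ofReal (Finset.prod_nonneg fun _ _ => by positivity)]
  induction k with
  | zero =>
    have hv : (volume : Measure (HermitianEntries 0)) Set.univ = 1 := by
      rw [Measure.volume_eq_prod, ← Set.univ_prod_univ, Measure.prod_prod, volume_pi, volume_pi,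
        Measure.pi_univ, Measure.pi_univ]
      simp
    simp [gueDensity, hv, Matrix.trace]
  | succ k ih =>
    -- Bordering adds `s² + 2 ∑ |v i|²` to the trace of the square; the new row therefore
    -- contributes `√(2π)` and `π ^ k`.
    have e : ∀ (s : ℝ) (v : Fin k → ℂ) (h : HermitianEntries k),
        ENNReal.ofReal (gueDensity (hermitianCons s v h)) =
        ENNReal.ofReal (Real.exp (-(1 / 2) * s ^ 2)) *
          (ENNReal.ofReal (Real.exp (-∑ i, ‖v i‖ ^ 2)) * ENNReal.ofReal (gueDensity h)) := by
      intro s v h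
      rw [← ENNReal.ofReal_mul (by positivity), ← ENNReal.ofReal_mul (by positivity)]
      congr 1
      rw [gueDensity, gueDensity, ← Real.exp_add, ← Real.exp_add,
        ← sum_norm_sq_eq_trace (isHermitian_hermitianOfEntries _),
        ← sum_norm_sq_eq_trace (isHermitian_hermitianOfEntries _), hermitianOfEntries_hermitianCons]
      congr 1
      simp only [Fin.sum_univ_succ, borderedMatrix_zero_zero, borderedMatrix_zero_succ,
        borderedMatrix_succ_zero, borderedMatrix_succ_succ, Finset.sum_add_distrib, RCLike.norm_conj,
        Complex.norm_real, Real.norm_eq_abs, sq_abs]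
      ring
    rw [lintegral_hermitianEntries_succ _ measurable_gueDensity.ennreal_ofReal]
    simp_rw [e]
    have h1 : ∀ (s : ℝ) (v : Fin k → ℂ), ∫⁻ h : HermitianEntries k,
        ENNReal.ofReal (Real.exp (-(1 / 2) * s ^ 2)) *
          (ENNReal.ofReal (Real.exp (-∑ i, ‖v i‖ ^ 2)) * ENNReal.ofReal (gueDensity h)) =
        ENNReal.ofReal (Real.exp (-(1 / 2) * s ^ 2)) *
          (ENNReal.ofReal (Real.exp (-∑ i, ‖v i‖ ^ 2)) *
          ENNReal.ofReal (∏ j ∈ Finset.range k, (Real.sqrt (2 * Real.pi) * Real.pi ^ j))) := by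
      intro s v
      rw [lintegral_const_mul' _ _ ENNReal.ofReal_ne_top,
        lintegral_const_mul' _ _ ENNReal.ofReal_ne_top, ih]
    simp_rw [h1]
    have h2 : ∀ s : ℝ, ∫⁻ v : Fin k → ℂ, ENNReal.ofReal (Real.exp (-(1 / 2) * s ^ 2)) *
          (ENNReal.ofReal (Real.exp (-∑ i, ‖v i‖ ^ 2)) *
          ENNReal.ofReal (∏ j ∈ Finset.range k, (Real.sqrt (2 * Real.pi) * Real.pi ^ j))) =
        ENNReal.ofReal (Real.exp (-(1 / 2) * s ^ 2)) * (ENNReal.ofReal (Real.pi ^ k) *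
          ENNReal.ofReal (∏ j ∈ Finset.range k, (Real.sqrt (2 * Real.pi) * Real.pi ^ j))) := by
      intro s
      rw [lintegral_const_mul' _ _ ENNReal.ofReal_ne_top,
        lintegral_mul_const' _ _ ENNReal.ofReal_ne_top, lintegral_exp_neg_sum_norm_sq]
    simp_rw [h2]
    rw [lintegral_mul_const' _ _ (ENNReal.mul_ne_top ENNReal.ofReal_ne_top ENNReal.ofReal_ne_top),
      ← ofReal_integral_eq_lintegral_ofReal (integrable_exp_neg_mul_sq (by norm_num))
        (ae_of_all _ fun _ => (Real.exp_pos _).le), integral_gaussian,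
      ← ENNReal.ofReal_mul (by positivity), ← ENNReal.ofReal_mul (by positivity),
      Finset.prod_range_succ]
    congr 1
    rw [show Real.pi / (1 / 2) = 2 * Real.pi by ring]
    ring

end Gue

/-! ### The exact formula for the moment and the error bound. -/

section Asymptotics

open Matrix
open scoped ComplexOrder

variable {k : ℕ}

theorem measurable_prod_complexNormalPDF (k : ℕ) :
    Measurable fun v : Fin k → ℂ => ∏ j, complexNormalPDF (v j) :=
  Finset.measurable_prod _ fun j _ => measurable_complexNormalPDF.comp (measurable_pi_apply j)

theorem pi_stdComplexNormal_eq (k : ℕ) : Measure.pi (fun _ : Fin k => stdComplexNormal) =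
    volume.withDensity fun v => ∏ j, complexNormalPDF (v j) := by
  have hprob : IsProbabilityMeasure (volume.withDensity complexNormalPDF) := by
    rw [← stdComplexNormal_eq]; infer_instance
  refine Measure.ext_of_lintegral _ fun f hf => ?_
  rw [lintegral_withDensity_eq_lintegral_mul _ (measurable_prod_complexNormalPDF k) hf,
    stdComplexNormal_eq, lintegral_pi_withDensity _ _ measurable_complexNormalPDF _ _ hf]
  rfl

/-- Integration against the law of the array of entries in terms of its density. -/
theorem lintegral_iidComplexNormal (f : (Fin k → Fin k → ℂ) → ℝ≥0∞) (hf : Measurable f) :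
    ∫⁻ W, f W ∂iidComplexNormal k =
      ∫⁻ W : Fin k → Fin k → ℂ, (∏ i, ∏ j, complexNormalPDF (W i j)) * f W := by
  have hprob : IsProbabilityMeasure
      (volume.withDensity fun v : Fin k → ℂ => ∏ j, complexNormalPDF (v j)) := by
    rw [← pi_stdComplexNormal_eq]; infer_instance
  rw [iidComplexNormal, pi_stdComplexNormal_eq,
    lintegral_pi_withDensity _ _ (measurable_prod_complexNormalPDF k) _ _ hf]
  rfl

theorem prod_complexNormalPDF_eq (W : Fin k → Fin k → ℂ) :
    ∏ i, ∏ j, complexNormalPDF (W i j) = ENNReal.ofReal ((Real.pi ^ (k * k))⁻¹ *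
      Real.exp (-(Matrix.of W * (Matrix.of W)ᴴ).trace.re)) := by
  have h : (Matrix.of W * (Matrix.of W)ᴴ).trace.re = ∑ i, ∑ j, ‖W i j‖ ^ 2 := by
    simp only [Matrix.trace, Matrix.diag_apply, Matrix.mul_apply, Complex.re_sum,
      Matrix.conjTranspose_apply, Matrix.of_apply]
    refine Finset.sum_congr rfl fun i _ => Finset.sum_congr rfl fun j _ => ?_
    rw [RCLike.star_def, Complex.mul_conj, Complex.ofReal_re, Complex.normSq_eq_norm_sq]
  rw [h]
  simp only [complexNormalPDF]
  have h' : ∀ i, ∏ j, ENNReal.ofReal (Real.pi⁻¹ * Real.exp (-‖W i j‖ ^ 2)) =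
      ENNReal.ofReal (∏ j, (Real.pi⁻¹ * Real.exp (-‖W i j‖ ^ 2))) := fun i =>
    (ENNReal.ofReal_prod_of_nonneg fun _ _ => by positivity).symm
  simp_rw [h']
  rw [← ENNReal.ofReal_prod_of_nonneg (fun _ _ => by positivity)]
  simp only [Finset.prod_mul_distrib, ← Real.exp_sum, Finset.sum_neg_distrib, Finset.prod_const,
    Finset.card_univ, Fintype.card_fin, inv_pow, ← pow_mul]

theorem norm_matrix_det_measurable {X : Type*} [MeasurableSpace X]
    {M : X → Matrix (Fin k) (Fin k) ℂ} (hM : ∀ i j, Measurable fun x => M x i j) (N : ℕ) :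
    Measurable fun x => ‖(M x).det‖ ^ N :=
  (measurable_matrix_comp (φ := Matrix.det) measurable_det_of hM).norm.pow_const N

theorem measurable_smul_one_add_smul {X : Type*} [MeasurableSpace X]
    {M : X → Matrix (Fin k) (Fin k) ℂ} (hM : ∀ i j, Measurable fun x => M x i j) (a b : ℝ)
    (i j : Fin k) :
    Measurable fun x => ((a : ℂ) • (1 : Matrix (Fin k) (Fin k) ℂ) + (b : ℂ) • M x) i j := by
  simp only [Matrix.add_apply, Matrix.smul_apply, smul_eq_mul]
  exact measurable_const.add ((hM i j).const_mul _)

theorem measurable_mul_conjTranspose (i j : Fin k) :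
    Measurable fun W : Fin k → Fin k → ℂ => (Matrix.of W * (Matrix.of W)ᴴ) i j := by
  simp only [Matrix.mul_apply, Matrix.conjTranspose_apply, Matrix.of_apply]
  fun_prop

/-- Duality: the moment as an integral over `k × k` matrices. -/
theorem ginibreMoment_eq_integral (N k : ℕ) (z : ℂ) : ginibreMoment N k z =
    ∫ W, ‖(((‖z‖ ^ 2 : ℝ) : ℂ) • (1 : Matrix (Fin k) (Fin k) ℂ) +
      ((((Real.sqrt N)⁻¹ ^ 2 : ℝ)) : ℂ) • (Matrix.of W * (Matrix.of W)ᴴ)).det‖ ^ N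
        ∂iidComplexNormal k := by
  have h := integral_norm_det_pow_eq N k (Real.sqrt N)⁻¹ z
  have h1 : ginibreMoment N k z = ∫ g, ‖((((Real.sqrt N)⁻¹ : ℝ) : ℂ) • Matrix.of g -
      z • (1 : Matrix (Fin N) (Fin N) ℂ)).det‖ ^ (2 * k) ∂iidComplexNormal N := by
    simp only [ginibreMoment, ginibreMatrix, Complex.ofReal_inv]
  rw [← h1] at h
  rw [← Complex.ofReal_inj, h, ← integral_complex_ofReal]
  refine integral_congr_ae (ae_of_all _ fun W => ?_)
  -- The matrix is positive semidefinite, so its determinant equals its own norm and the complex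
  -- identity becomes a real one.
  have hp : (((‖z‖ ^ 2 : ℝ) : ℂ) • (1 : Matrix (Fin k) (Fin k) ℂ) +
      ((((Real.sqrt N)⁻¹ ^ 2 : ℝ)) : ℂ) • (Matrix.of W * (Matrix.of W)ᴴ)).PosSemidef :=
    (Matrix.PosSemidef.one.smul (Complex.zero_le_real.2 (by positivity))).add
      ((Matrix.posSemidef_self_mul_conjTranspose _).smul (Complex.zero_le_real.2 (by positivity)))
  have e := Complex.eq_coe_norm_of_nonneg hp.det_nonneg
  simp only [Complex.coe_smul] at e ⊢
  rw [Complex.ofReal_pow, ← e]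

theorem card_upperPairs (k : ℕ) : k + 2 * Fintype.card {p : Fin k × Fin k // p.1 < p.2} = k * k := by
  induction k with
  | zero => simp
  | succ k ih =>
    rw [← Fintype.card_congr (upperPairsSuccEquiv k), Fintype.card_sum, Fintype.card_fin]
    linarith

theorem finrank_hermitianEntries (k : ℕ) : Module.finrank ℝ (HermitianEntries k) = k * k := by
  rw [Module.finrank_prod, Module.finrank_fintype_fun_eq_card, Module.finrank_pi_fintype]
  simp only [Complex.finrank_real_complex, Finset.sum_const, Finset.card_univ, Fintype.card_fin,
    smul_eq_mul]
  rw [mul_comm _ 2, card_upperPairs]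

theorem lintegral_eq_lintegral_smul_add (g : HermitianEntries k → ℝ≥0∞) (hg : Measurable g)
    {r : ℝ} (hr : 0 < r) (h₀ : HermitianEntries k) :
    ∫⁻ h, g h = ENNReal.ofReal (r ^ (k * k)) * ∫⁻ h, g (r • h + h₀) := by
  have hga : Measurable fun h => g (h + h₀) := hg.comp (measurable_add_const h₀)
  have h1 : ∫⁻ h, g (r • h + h₀) = ENNReal.ofReal (r ^ (k * k))⁻¹ * ∫⁻ h, g h := by
    rw [← lintegral_map (f := fun h => g (h + h₀)) (g := fun h : HermitianEntries k => r • h) hga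
      (measurable_const_smul r), Measure.map_addHaar_smul _ hr.ne', lintegral_smul_measure,
      lintegral_add_right_eq_self, finrank_hermitianEntries, abs_of_pos (by positivity), smul_eq_mul]
  rw [h1, ← mul_assoc, ← ENNReal.ofReal_mul (by positivity), mul_inv_cancel₀ (by positivity),
    ENNReal.ofReal_one, one_mul]

theorem isHermitian_ofReal_smul_one (x : ℝ) :
    ((x : ℂ) • (1 : Matrix (Fin k) (Fin k) ℂ)).IsHermitian := by
  ext i j
  by_cases hij : i = j
  · subst hij; simp
  · simp [hij, Ne.symm hij]

/-- Eigenvalues above `-x ≥ -√N` keep `1 + u/√N` positive, so the truncation in `gaussApprox` is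
inactive on the cone. -/
theorem gaussApproxDet_eq_of_mem {N : ℕ} (hN : 0 < N) {x : ℝ} (hx : x ≤ Real.sqrt N)
    {h : HermitianEntries k} (hh : h ∈ shiftedCone k x) : gaussApproxDet N h =
      ‖(((1 : ℝ) : ℂ) • (1 : Matrix (Fin k) (Fin k) ℂ) +
        (((Real.sqrt N)⁻¹ : ℝ) : ℂ) • hermitianOfEntries h).det‖ ^ N *
        Real.exp (-(Real.sqrt N * (hermitianOfEntries h).trace.re)) := by
  rw [gaussApproxDet_eq, Set.indicator_of_mem]
  rw [Set.mem_ofPred_eq, posDef_smul_one_add_smul_iff (isHermitian_hermitianOfEntries h)]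
  intro i
  have hR : 0 < Real.sqrt N := Real.sqrt_pos.2 (by exact_mod_cast hN)
  have h1 := mem_shiftedCone_iff.1 hh i
  have h2 := mul_pos (inv_pos.2 hR) (h1.trans_le (add_le_add_left hx _))
  rwa [mul_add, inv_mul_cancel₀ hR.ne'] at h2

/-- The substitution `S = R h + R x`, with `R = √N` and `x = R (1 - |z|²)`, makes `|z|² + S/N` equal
to `1 + h/R`, since `x / R = 1 - |z|²`. The trace of the shift is `N k (1 - |z|²)`. -/
theorem ginibreMoment_eq {N : ℕ} (hN : 0 < N) (k : ℕ) (z : ℂ) : ginibreMoment N k z =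
    wishartConst k * ((Real.pi ^ (k * k))⁻¹ * Real.exp (N * k * (‖z‖ ^ 2 - 1))) *
      Real.sqrt N ^ (k * k) *
      ∫ h in shiftedCone k (Real.sqrt N * (1 - ‖z‖ ^ 2)), gaussApproxDet N h := by
  set R := Real.sqrt N with hRdef
  set a := ‖z‖ ^ 2 with ha
  have ha0 : 0 ≤ a := by positivity
  have hR : 0 < R := Real.sqrt_pos.2 (by exact_mod_cast hN)
  have hRR : R * R = N := Real.mul_self_sqrt (Nat.cast_nonneg N)
  set x := R * (1 - a) with hxdef
  have hx : x ≤ R := by rw [hxdef]; nlinarith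
  let φ : Matrix (Fin k) (Fin k) ℂ → ℝ≥0∞ := fun S =>
    ENNReal.ofReal ((Real.pi ^ (k * k))⁻¹ * Real.exp (-S.trace.re)) *
      ENNReal.ofReal (‖((a : ℂ) • (1 : Matrix (Fin k) (Fin k) ℂ) +
        ((R⁻¹ ^ 2 : ℝ) : ℂ) • S).det‖ ^ N)
  have hφ : Measurable fun A : Fin k → Fin k → ℂ => φ (Matrix.of A) := by
    have hA : ∀ i j, Measurable fun A : Fin k → Fin k → ℂ => Matrix.of A i j := fun i j => by
      simp only [Matrix.of_apply]; fun_prop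
    have ht : Measurable fun A : Fin k → Fin k → ℂ => (Matrix.of A).trace.re :=
      Complex.measurable_re.comp (Finset.measurable_sum _ fun i _ => hA i i)
    exact (ht.neg.exp.const_mul _).ennreal_ofReal.mul
      (norm_matrix_det_measurable (measurable_smul_one_add_smul hA _ _) N).ennreal_ofReal
  have hmeas := norm_matrix_det_measurable
    (measurable_smul_one_add_smul (measurable_mul_conjTranspose (k := k)) a (R⁻¹ ^ 2)) N
  have hφh : Measurable fun h : HermitianEntries k => φ (hermitianOfEntries h) :=
    measurable_matrix_comp hφ measurable_hermitianOfEntries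
  have hI : ∀ h : HermitianEntries k,
      {h : HermitianEntries k | (hermitianOfEntries h).PosDef}.indicator
        (fun h => φ (hermitianOfEntries h)) (R • h + entriesOfMatrix
          (((R * x : ℝ) : ℂ) • (1 : Matrix (Fin k) (Fin k) ℂ))) =
      ENNReal.ofReal ((Real.pi ^ (k * k))⁻¹ * Real.exp (N * k * (a - 1))) *
        (shiftedCone k x).indicator (fun h => ENNReal.ofReal (gaussApproxDet N h)) h := by
    intro h
    have e1 : hermitianOfEntries (R • h + entriesOfMatrix
        (((R * x : ℝ) : ℂ) • (1 : Matrix (Fin k) (Fin k) ℂ))) =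
        ((R * x : ℝ) : ℂ) • (1 : Matrix (Fin k) (Fin k) ℂ) + (R : ℂ) • hermitianOfEntries h := by
      rw [hermitianOfEntries_add, hermitianOfEntries_smul,
        hermitianOfEntries_entriesOfMatrix (isHermitian_ofReal_smul_one _), add_comm]
    have e2 : R • h + entriesOfMatrix (((R * x : ℝ) : ℂ) • (1 : Matrix (Fin k) (Fin k) ℂ)) ∈
        {h : HermitianEntries k | (hermitianOfEntries h).PosDef} ↔ h ∈ shiftedCone k x := by
      rw [Set.mem_ofPred_eq, e1, posDef_smul_one_add_smul_iff (isHermitian_hermitianOfEntries h), mem_shiftedCone_iff]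
      refine forall_congr' fun i => ?_
      rw [← mul_add, mul_pos_iff_of_pos_left hR]
    by_cases hh : h ∈ shiftedCone k x
    · rw [Set.indicator_of_mem (e2.2 hh), Set.indicator_of_mem hh, gaussApproxDet_eq_of_mem hN hx hh]
      simp only [φ]
      rw [e1, ← ENNReal.ofReal_mul (by positivity), ← ENNReal.ofReal_mul (by positivity)]
      have e3 : (a : ℂ) • (1 : Matrix (Fin k) (Fin k) ℂ) + ((R⁻¹ ^ 2 : ℝ) : ℂ) •
          (((R * x : ℝ) : ℂ) • (1 : Matrix (Fin k) (Fin k) ℂ) + (R : ℂ) • hermitianOfEntries h) =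
          ((1 : ℝ) : ℂ) • (1 : Matrix (Fin k) (Fin k) ℂ) +
            ((R⁻¹ : ℝ) : ℂ) • hermitianOfEntries h := by
        rw [smul_add, smul_smul, smul_smul, ← add_assoc, ← add_smul, ← Complex.ofReal_mul,
          ← Complex.ofReal_mul, ← Complex.ofReal_add]
        congr 3
        · rw [hxdef]; field_simp; ring
        · field_simp
      have e4 : (((R * x : ℝ) : ℂ) • (1 : Matrix (Fin k) (Fin k) ℂ) +
          (R : ℂ) • hermitianOfEntries h).trace.re =
          -(N * k * (a - 1)) + R * (hermitianOfEntries h).trace.re := by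
        rw [Matrix.trace_add, Matrix.trace_smul, Matrix.trace_smul, Matrix.trace_one, Complex.add_re,
          smul_eq_mul, smul_eq_mul, Complex.re_ofReal_mul, Complex.re_ofReal_mul, Fintype.card_fin,
          Complex.natCast_re, hxdef, ← hRR]
        ring
      rw [e3, e4, neg_add, neg_neg, Real.exp_add]
      congr 1
      ring
    · rw [Set.indicator_of_notMem (mt e2.1 hh), Set.indicator_of_notMem hh, mul_zero]
  rw [ginibreMoment_eq_integral, integral_eq_lintegral_of_nonneg_ae
      (ae_of_all _ fun _ => by positivity) hmeas.aestronglyMeasurable,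
    lintegral_iidComplexNormal _ hmeas.ennreal_ofReal]
  have e5 : ∫⁻ W : Fin k → Fin k → ℂ, (∏ i, ∏ j, complexNormalPDF (W i j)) *
      ENNReal.ofReal (‖((a : ℂ) • (1 : Matrix (Fin k) (Fin k) ℂ) +
        ((R⁻¹ ^ 2 : ℝ) : ℂ) • (Matrix.of W * (Matrix.of W)ᴴ)).det‖ ^ N) =
      ∫⁻ W : Fin k → Fin k → ℂ, φ (Matrix.of W * (Matrix.of W)ᴴ) :=
    lintegral_congr fun W => by rw [prod_complexNormalPDF_eq]
  rw [e5, lintegral_mul_conjTranspose k φ hφ, lintegral_eq_lintegral_smul_add _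
    (hφh.indicator (measurableSet_posDef measurable_hermitianOfEntries)) hR
    (entriesOfMatrix (((R * x : ℝ) : ℂ) • (1 : Matrix (Fin k) (Fin k) ℂ)))]
  simp_rw [hI]
  rw [lintegral_const_mul' _ _ ENNReal.ofReal_ne_top, lintegral_indicator (measurableSet_shiftedCone x),
    ← ofReal_integral_eq_lintegral_ofReal (integrable_gaussApproxDet hN).integrableOn
      (ae_of_all _ fun h => gaussApproxDet_nonneg N h),
    ENNReal.toReal_mul, ENNReal.toReal_mul, ENNReal.toReal_mul,
    ENNReal.toReal_ofReal (wishartConst_pos k).le, ENNReal.toReal_ofReal (by positivity),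
    ENNReal.toReal_ofReal (by positivity),
    ENNReal.toReal_ofReal (integral_nonneg fun h => gaussApproxDet_nonneg N h)]
  ring

/-- All powers of `π` from the Wishart and GUE constants cancel because `∑ (2j + 1) = k²` over `j <
k`. -/
theorem wishartConst_mul_integral_gueDensity (k : ℕ) :
    wishartConst k * (Real.pi ^ (k * k))⁻¹ * ∫ h : HermitianEntries k, gueDensity h =
      (2 * Real.pi) ^ ((k : ℝ) / 2) / barnesG (1 + k) := by
  have h1 : ((2 * Real.pi) ^ ((k : ℝ) / 2) : ℝ) = Real.sqrt (2 * Real.pi) ^ k := by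
    rw [Real.sqrt_eq_rpow, ← Real.rpow_natCast, ← Real.rpow_mul (by positivity)]
    congr 1
    ring
  have h2 : (∏ j ∈ Finset.range k, Real.pi ^ (j + 1)) * ∏ j ∈ Finset.range k, Real.pi ^ j =
      Real.pi ^ (k * k) := by
    induction k with
    | zero => simp
    | succ k ih =>
      rw [Finset.prod_range_succ, Finset.prod_range_succ, mul_mul_mul_comm, ih (by
        rw [Real.sqrt_eq_rpow, ← Real.rpow_natCast, ← Real.rpow_mul (by positivity)]
        congr 1
        ring), ← pow_add, ← pow_add]
      congr 1
      ring
  rw [h1, barnesG_one_add_natCast, integral_gueDensity, wishartConst, Finset.prod_div_distrib,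
    Finset.prod_mul_distrib, Finset.prod_const, Finset.card_range, ← h2]
  have h3 : (∏ j ∈ Finset.range k, (j.factorial : ℝ)) ≠ 0 :=
    Finset.prod_ne_zero_iff.2 fun j _ => by positivity
  have h4 : (∏ j ∈ Finset.range k, Real.pi ^ (j + 1)) ≠ 0 :=
    Finset.prod_ne_zero_iff.2 fun j _ => by positivity
  have h5 : (∏ j ∈ Finset.range k, Real.pi ^ j) ≠ 0 :=
    Finset.prod_ne_zero_iff.2 fun j _ => by positivity
  field_simp

theorem exp_half_sq_mul_log {N : ℕ} (hN : 0 < N) (k : ℕ) :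
    Real.exp ((k : ℝ) ^ 2 / 2 * Real.log N) = Real.sqrt N ^ (k * k) := by
  have hN' : (0 : ℝ) < N := by exact_mod_cast hN
  rw [Real.sqrt_eq_rpow, ← Real.rpow_mul_natCast hN'.le, Real.rpow_def_of_pos hN']
  congr 1
  push_cast
  ring

theorem shiftedCone_mono {x y : ℝ} (hxy : x ≤ y) : shiftedCone k x ⊆ shiftedCone k y :=
  fun _ hh => mem_shiftedCone_iff.2 fun i =>
    (mem_shiftedCone_iff.1 hh i).trans_le (add_le_add_left hxy _)

/-- The moment, up to the ratio of an integral to its limit. -/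
theorem ginibreMoment_eq_mul {N : ℕ} (hN : 0 < N) (k : ℕ) (z : ℂ) : ginibreMoment N k z =
    Real.exp ((N : ℝ) * k * (‖z‖ ^ 2 - 1) + (k : ℝ) ^ 2 / 2 * Real.log N) *
      ((2 * Real.pi) ^ ((k : ℝ) / 2) / barnesG (1 + k)) *
      gueMaxCDF k (Real.sqrt N * (1 - ‖z‖ ^ 2)) *
      ((∫ h in shiftedCone k (Real.sqrt N * (1 - ‖z‖ ^ 2)), gaussApproxDet N h) /
        ∫ h in shiftedCone k (Real.sqrt N * (1 - ‖z‖ ^ 2)), gueDensity h) := by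
  have h1 := (setIntegral_gueDensity_pos (k := k) (Real.sqrt N * (1 - ‖z‖ ^ 2))).ne'
  have h2 : (∫ h : HermitianEntries k, gueDensity h) ≠ 0 := by
    rw [integral_gueDensity]
    exact Finset.prod_ne_zero_iff.2 fun j _ => by positivity
  rw [ginibreMoment_eq hN, gueMaxCDF_eq, Real.exp_add, exp_half_sq_mul_log hN,
    ← wishartConst_mul_integral_gueDensity]
  field_simp

/-- The numerator of the error is enlarged to the whole space, and the denominator is decreased to
the smaller cone at `x`; the bound then depends on `y` only through `x ≤ y`. -/
theorem abs_ratio_sub_one_le {N : ℕ} (hN : 0 < N) {x y : ℝ} (hxy : x ≤ y) :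
    |(∫ h in shiftedCone k y, gaussApproxDet N h) / (∫ h in shiftedCone k y, gueDensity h) - 1| ≤
      (∫ h : HermitianEntries k, |gaussApproxDet N h - gueDensity h|) /
        ∫ h in shiftedCone k x, gueDensity h := by
  have hx := setIntegral_gueDensity_pos (k := k) x
  have hy := setIntegral_gueDensity_pos (k := k) y
  have hi := (integrable_gaussApproxDet (k := k) hN).sub integrable_gueDensity
  rw [div_sub_one hy.ne', abs_div, abs_of_pos hy]
  refine div_le_div₀ (integral_nonneg fun _ => abs_nonneg _) ?_ hx
    (setIntegral_mono_set integrable_gueDensity.integrableOn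
      (ae_of_all _ fun h => (gueDensity_pos h).le) (shiftedCone_mono hxy).eventuallyLE)
  rw [← integral_sub (integrable_gaussApproxDet hN).integrableOn integrable_gueDensity.integrableOn]
  exact (abs_integral_le_integral_abs).trans
    (setIntegral_le_integral hi.abs (ae_of_all _ fun h => abs_nonneg _))

end Asymptotics

end

theorem mainTheorem1 (L : ℝ) (hL : 0 < L) (k : ℕ) :
    ∀ ε : ℝ, 0 < ε → ∀ᶠ N : ℕ in atTop,
      ∀ z ∈ Metric.closedBall (0 : ℂ) (1 + L / Real.sqrt N),
        ∃ δ : ℝ, |δ| ≤ ε ∧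
          ginibreMoment N k z =
            Real.exp ((N : ℝ) * k * (‖z‖ ^ 2 - 1) + (k : ℝ) ^ 2 / 2 * Real.log N) *
              ((2 * Real.pi) ^ ((k : ℝ) / 2) / barnesG (1 + k)) *
              gueMaxCDF k (Real.sqrt N * (1 - ‖z‖ ^ 2)) * (1 + δ) := by
  intro ε hε
  -- At `|z| = 1 + L/√N` one has `√N (1 - |z|²) = -(2L + L²/√N)`, which is at least `-(2L + L²)`;
  -- this cone lies in all those that occur.
  have hlim := (tendsto_integral_abs_gaussApproxDet_sub k).div_const
    (∫ h in shiftedCone k (-(2 * L + L ^ 2)), gueDensity h)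
  rw [zero_div] at hlim
  filter_upwards [hlim.eventually_le_const hε, eventually_gt_atTop 0] with N hNε hN z hz
  have hR : 1 ≤ Real.sqrt N := Real.one_le_sqrt.2 (by exact_mod_cast hN)
  rw [mem_closedBall_zero_iff] at hz
  have hx : -(2 * L + L ^ 2) ≤ Real.sqrt N * (1 - ‖z‖ ^ 2) := by
    have h1 : ‖z‖ ^ 2 ≤ (1 + L / Real.sqrt N) ^ 2 := by gcongr
    have h2 : Real.sqrt N * (1 - ‖z‖ ^ 2) ≥ Real.sqrt N * (1 - (1 + L / Real.sqrt N) ^ 2) := by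
      gcongr
    have h3 : Real.sqrt N * (1 - (1 + L / Real.sqrt N) ^ 2) = -(2 * L + L ^ 2 / Real.sqrt N) := by
      field_simp; ring
    have h4 : L ^ 2 / Real.sqrt N ≤ L ^ 2 := div_le_self (by positivity) hR
    linarith
  -- The witness `δ` is the ratio of the two cone integrals minus one.
  refine ⟨_, (abs_ratio_sub_one_le hN hx).trans hNε, ?_⟩
  rw [add_sub_cancel, ginibreMoment_eq_mul hN]
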